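/- Notation: $(t)_k=t(t+1)\cdots(t+k-1)$ is the Pochhammer symbol, $\theta$ the sign function, ${}_2F_1$ the Gauss hypergeometric function, and $\delta_{nm}$ the Kronecker delta. For real $a,b>-1$ and $c$ with $|c|\neq1$, and with $z=\frac{1-x^2}{1-c^2}$, the Big $-1$ Jacobi polynomials are $$J_n(x;a,b,c)={}_2F_1\Big(-\tfrac n2,\tfrac{n+a+b+2}{2};\tfrac{a+1}{2};z\Big)+\tfrac{n(1-x)}{(1+c)(a+1)}\,{}_2F_1\Big(1-\tfrac n2,\tfrac{n+a+b+2}{2};\tfrac{a+3}{2};z\Big)\quad(n\text{ even}),$$ $$J_n(x;a,b,c)={}_2F_1\Big(-\tfrac{n-1}2,\tfrac{n+a+b+1}{2};\tfrac{a+1}{2};z\Big)-\tfrac{(n+a+b+1)(1-x)}{(1+c)(a+1)}\,{}_2F_1\Big(-\tfrac{n-1}2,\tfrac{n+a+b+3}{2};\tfrac{a+3}{2};z\Big)\quad(n\text{ odd}),$$ the second term being $0$ for $n=0$. The Chihara polynomials are $$C_{2n}(x;\alpha,\beta,\gamma)=(-1)^n\tfrac{(\alpha+1)_n}{(n+\alpha+\beta+1)_n}\,{}_2F_1(-n,n+\alpha+\beta+1;\alpha+1;x^2-\gamma^2),$$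 $$C_{2n+1}(x;\alpha,\beta,\gamma)=(-1)^n\tfrac{(\alpha+2)_n}{(n+\alpha+\beta+2)_n}(x-\gamma)\,{}_2F_1(-n,n+\alpha+\beta+2;\alpha+2;x^2-\gamma^2).$$ Define $$h_n(a,b)=\widetilde h_n(a,b)=\begin{cases}\dfrac{2\,\Gamma(\frac{n+b+1}{2})\Gamma(\frac{n+a+3}{2})(\frac n2)!}{(n+a+1)\Gamma(\frac{n+a+b+2}{2})\big(\frac{a+1}{2}\big)_{n/2}^2},& n\text{ even},\\[3mm]\dfrac{(n+a+b+1)\Gamma(\frac{n+b+2}{2})\Gamma(\frac{n+a+2}{2})(\frac{n-1}2)!}{2\,\Gamma(\frac{n+a+b+3}{2})\big(\frac{a+1}{2}\big)_{(n+1)/2}^2},& n\text{ odd},\end{cases}$$ $$\kappa_n=\begin{cases}\dfrac{(1-c^2)^{n/2}(\frac{a+1}{2})_{n/2}}{(\frac{n+a+b+2}{2})_{n/2}},& n\text{ even},\\[3mm]\dfrac{(1+c)(1-c^2)^{(n-1)/2}(\frac{a+1}{2})_{(n+1)/2}}{(\frac{n+a+b+1}{2})_{(n+1)/2}},& n\text{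 odd},\end{cases}$$ and $\widehat J_n=\kappa_nJ_n$. Let $$\omega(x)=\theta(x)(1+x)(x-c)(x^2-c^2)^{\frac{b-1}2}(1-x^2)^{\frac{a-1}2},\qquad \widetilde\omega(x)=\theta(cx)(1+x)(c-x)(c^2-x^2)^{\frac{b-1}2}(x^2-1)^{\frac{a-1}2},$$ $\mathcal C=[-1,-|c|]\cup[|c|,1]$, $\widetilde{\mathcal C}=[-|c|,-1]\cup[1,|c|]$, and let $\mathcal M[f]$ denote $\int_{\mathcal C}f\omega\,dx$ if $|c|<1$ and $\int_{\widetilde{\mathcal C}}f\widetilde\omega\,dx$ if $|c|>1$. For all $n,m\ge0$ the following hold. 1. If $a,b>-1$ and $|c|<1$, then every polynomial times $\omega$ is integrable on $\mathcal C$ and $$\int_{\mathcal C}J_nJ_m\,\omega\,dx=\frac{(1-c^2)^{\frac{a+b+2}{2}}}{1+c}\,h_n(a,b)\,\delta_{nm}.$$ 2. If $a,b>-1$ and $|c|>1$, then every polynomial times $\widetilde\omega$ is integrable on $\widetilde{\mathcal C}$ and $$\int_{\widetilde{\mathcal C}}J_nJ_m\,\widetilde\omega\,dx=\frac{\theta(c)(c^2-1)^{\frac{a+b+2}{2}}}{1+c}\,\widetilde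 h_n(a,b)\,\delta_{nm}.$$ 3. If $a,b>-1$ and $|c|\ne1$, then $\widehat J_n$ is a monic polynomial of degree $n$ with $\widehat J_n(1)\neq0$; its Christoffel transform at $\nu=1$, $$\widetilde K_n(x)=\frac{\widehat J_{n+1}(x)-\frac{\widehat J_{n+1}(1)}{\widehat J_n(1)}\widehat J_n(x)}{x-1},$$ is a monic polynomial of degree $n$, and $$\widetilde K_n(x)=s^n\,C_n\Big(\frac xs;\frac{b-1}2,\frac{a+1}2,\frac{-c}{s}\Big)$$ with $s=\sqrt{1-c^2}$ if $|c|<1$, and with either complex square root $s$ of $1-c^2$ for all $|c|\ne1$. Moreover, for $0\le k\le n$, $$\mathcal M[(x-1)\widetilde K_n(x)\,x^k]=-\frac{\widehat J_{n+1}(1)}{\widehat J_n(1)}\,\mathcal M[\widehat J_n^2]\,\delta_{kn},\qquad \mathcal M[(x-1)\widetilde K_n^2]=-\frac{\widehat J_{n+1}(1)}{\widehat J_n(1)}\,\mathcal M[\widehat J_n^2].$$ 4. If $\alpha,\beta>-1$ and $\gamma\in\mathbb R$, put $\mathcal E=[-\sqrt{1+\gamma^2},-|\gamma|]\cup[|\gamma|,\sqrt{1+\gamma^2}]$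 and $w(x)=\theta(x)(x+\gamma)(x^2-\gamma^2)^\alpha(1+\gamma^2-x^2)^\beta$. Then every polynomial times $w$ is integrable on $\mathcal E$ and $\int_{\mathcal E}C_nC_m\,w\,dx=\eta_n\delta_{nm}$, where $$\eta_{2n}=\frac{\Gamma(n+\alpha+1)\Gamma(n+\beta+1)}{\Gamma(n+\alpha+\beta+1)}\frac{n!}{(2n+\alpha+\beta+1)[(n+\alpha+\beta+1)_n]^2},$$ $$\eta_{2n+1}=\frac{\Gamma(n+\alpha+2)\Gamma(n+\beta+1)}{\Gamma(n+\alpha+\beta+2)}\frac{n!}{(2n+\alpha+\beta+2)[(n+\alpha+\beta+2)_n]^2},$$ and for $n=0$ the denominator $\Gamma(\alpha+\beta+1)(\alpha+\beta+1)$ is read as $\Gamma(\alpha+\beta+2)$ (which matters only if $\alpha+\beta=-1$). -/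

import Mathlib

open MeasureTheory Polynomial
open scoped Nat

noncomputable section

namespace BigJacobi

/-- The Pochhammer symbol `(t)_k = t (t + 1) ⋯ (t + k - 1)`. -/
def poch {𝕜 : Type*} [Field 𝕜] (t : 𝕜) (k : ℕ) : 𝕜 := (ascPochhammer 𝕜 k).eval t

/-- The Big -1 Jacobi polynomial `J_n(x; a, b, c)`. All the hypergeometric series are terminating
(for `n = 0` the second term has the factor `n = 0`). -/
def J (a b c : ℝ) (n : ℕ) (x : ℝ) : ℝ :=
  if Even n then
    ₂F₁ (-(n : ℝ) / 2) ((n + a + b + 2) / 2) ((a + 1) / 2) ((1 - x ^ 2) / (1 - c ^ 2))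
      + n * (1 - x) / ((1 + c) * (a + 1)) *
        ₂F₁ (1 - (n : ℝ) / 2) ((n + a + b + 2) / 2) ((a + 3) / 2) ((1 - x ^ 2) / (1 - c ^ 2))
  else
    ₂F₁ (-((n : ℝ) - 1) / 2) ((n + a + b + 1) / 2) ((a + 1) / 2) ((1 - x ^ 2) / (1 - c ^ 2))
      - (n + a + b + 1) * (1 - x) / ((1 + c) * (a + 1)) *
        ₂F₁ (-((n : ℝ) - 1) / 2) ((n + a + b + 3) / 2) ((a + 3) / 2) ((1 - x ^ 2) / (1 - c ^ 2))

/-- The orthogonality domain for `|c| < 1`. -/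
def domain (c : ℝ) : Set ℝ := Set.Icc (-1) (-|c|) ∪ Set.Icc |c| 1

/-- The weight function for `|c| < 1`. -/
def weight (a b c x : ℝ) : ℝ :=
  Real.sign x * (1 + x) * (x - c) * (x ^ 2 - c ^ 2) ^ ((b - 1) / 2) *
    (1 - x ^ 2) ^ ((a - 1) / 2)

/-- The normalization factor `h_n(a, b)`. -/
def h (a b : ℝ) (n : ℕ) : ℝ :=
  if Even n then
    2 * Real.Gamma ((n + b + 1) / 2) * Real.Gamma ((n + a + 3) / 2) * ((n / 2)! : ℕ) /
      ((n + a + 1) * Real.Gamma ((n + a + b + 2) / 2) * poch ((a + 1) / 2) (n / 2) ^ 2)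
  else
    (n + a + b + 1) * Real.Gamma ((n + b + 2) / 2) * Real.Gamma ((n + a + 2) / 2) *
        (((n - 1) / 2)! : ℕ) /
      (2 * Real.Gamma ((n + a + b + 3) / 2) * poch ((a + 1) / 2) ((n + 1) / 2) ^ 2)

/-- The orthogonality domain for `|c| > 1`. -/
def domainTilde (c : ℝ) : Set ℝ := Set.Icc (-|c|) (-1) ∪ Set.Icc 1 |c|

/-- The weight function for `|c| > 1`. -/
def weightTilde (a b c x : ℝ) : ℝ :=
  Real.sign (c * x) * (1 + x) * (c - x) * (c ^ 2 - x ^ 2) ^ ((b - 1) / 2) *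
    (x ^ 2 - 1) ^ ((a - 1) / 2)

/-- The normalization factor for `|c| > 1`; it is given by the same expression as `h`. -/
def hTilde (a b : ℝ) (n : ℕ) : ℝ :=
  if Even n then
    2 * Real.Gamma ((n + b + 1) / 2) * Real.Gamma ((n + a + 3) / 2) * ((n / 2)! : ℕ) /
      ((n + a + 1) * Real.Gamma ((n + a + b + 2) / 2) * poch ((a + 1) / 2) (n / 2) ^ 2)
  else
    (n + a + b + 1) * Real.Gamma ((n + b + 2) / 2) * Real.Gamma ((n + a + 2) / 2) *
        (((n - 1) / 2)! : ℕ) /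
      (2 * Real.Gamma ((n + a + b + 3) / 2) * poch ((a + 1) / 2) ((n + 1) / 2) ^ 2)

/-- The orthogonality functional of the Big -1 Jacobi polynomials, for `|c| ≠ 1`. -/
def functional (a b c : ℝ) (f : ℝ → ℝ) : ℝ :=
  if |c| < 1 then ∫ x in domain c, f x * weight a b c x
  else ∫ x in domainTilde c, f x * weightTilde a b c x

/-- The factor `κ_n(a, b, c)` which makes `κ_n J_n` monic. -/
def kappa (a b c : ℝ) (n : ℕ) : ℝ :=
  if Even n then
    (1 - c ^ 2) ^ (n / 2) * poch ((a + 1) / 2) (n / 2) / poch ((n + a + b + 2) / 2) (n / 2)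
  else
    (1 + c) * (1 - c ^ 2) ^ ((n - 1) / 2) * poch ((a + 1) / 2) ((n + 1) / 2) /
      poch ((n + a + b + 1) / 2) ((n + 1) / 2)

/-- The monic Big -1 Jacobi polynomial. -/
def monicJ (a b c : ℝ) (n : ℕ) (x : ℝ) : ℝ := kappa a b c n * J a b c n x

/-- The Christoffel transform with parameter `ν` of the monic Big -1 Jacobi polynomials, as a
quotient; only its values at `x ≠ ν` are meaningful. -/
def kernel (a b c ν : ℝ) (n : ℕ) (x : ℝ) : ℝ :=
  (monicJ a b c (n + 1) x - monicJ a b c (n + 1) ν / monicJ a b c n ν * monicJ a b c n x) /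
    (x - ν)

/-- The Chihara polynomial `C_n(x; α, β, γ)`, over the real or the complex numbers. -/
def chihara {𝕜 : Type*} [RCLike 𝕜] (α β γ : 𝕜) (n : ℕ) (x : 𝕜) : 𝕜 :=
  let m := n / 2
  if Even n then
    (-1) ^ m * (poch (α + 1) m / poch (m + α + β + 1) m) *
      ₂F₁ (-(m : 𝕜)) (m + α + β + 1) (α + 1) (x ^ 2 - γ ^ 2)
  else
    (-1) ^ m * (poch (α + 2) m / poch (m + α + β + 2) m) * (x - γ) *
      ₂F₁ (-(m : 𝕜)) (m + α + β + 2) (α + 2) (x ^ 2 - γ ^ 2)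

/-- The orthogonality domain of the Chihara polynomials. -/
def chiharaDomain (γ : ℝ) : Set ℝ :=
  Set.Icc (-√(1 + γ ^ 2)) (-|γ|) ∪ Set.Icc |γ| √(1 + γ ^ 2)

/-- The weight function of the Chihara polynomials. -/
def chiharaWeight (α β γ x : ℝ) : ℝ :=
  Real.sign x * (x + γ) * (x ^ 2 - γ ^ 2) ^ α * (1 + γ ^ 2 - x ^ 2) ^ β

/-- The normalization coefficients `η_n` of the Chihara polynomials. For `n = 0` the product
`Γ(α + β + 1) (α + β + 1)` is written as `Γ(α + β + 2)`, so that the value is the right one also in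
the removable case `α + β + 1 = 0`; see `chiharaEta_zero`. -/
def chiharaEta (α β : ℝ) (n : ℕ) : ℝ :=
  let m := n / 2
  if n = 0 then
    Real.Gamma (α + 1) * Real.Gamma (β + 1) / Real.Gamma (α + β + 2)
  else if Even n then
    Real.Gamma (m + α + 1) * Real.Gamma (m + β + 1) / Real.Gamma (m + α + β + 1) *
      ((m ! : ℕ) / ((2 * m + α + β + 1) * poch (m + α + β + 1) m ^ 2))
  else
    Real.Gamma (m + α + 2) * Real.Gamma (m + β + 1) / Real.Gamma (m + α + β + 2) *
      ((m ! : ℕ) / ((2 * m + α + β + 2) * poch (m + α + β + 2) m ^ 2))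

/-- For `α + β + 1 ≠ 0` the value of `η_0` is the general formula for even `n` at `n = 0`. -/
theorem chiharaEta_zero (α β : ℝ) (hαβ : α + β + 1 ≠ 0) :
    chiharaEta α β 0 =
      Real.Gamma (((0 : ℕ) : ℝ) + α + 1) * Real.Gamma (((0 : ℕ) : ℝ) + β + 1) /
          Real.Gamma (((0 : ℕ) : ℝ) + α + β + 1) *
        ((0 ! : ℕ) / ((2 * ((0 : ℕ) : ℝ) + α + β + 1) *
          poch (((0 : ℕ) : ℝ) + α + β + 1) 0 ^ 2)) := by
  have e : α + β + 2 = (α + β + 1) + 1 := by ring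
  simp only [chiharaEta, poch, if_true, e, Real.Gamma_add_one hαβ, ascPochhammer_zero,
    Polynomial.eval_one, Nat.factorial_zero, Nat.cast_zero, Nat.cast_one, zero_add, mul_zero,
    one_pow, mul_one]
  rw [div_mul_div_comm, mul_one, mul_comm (α + β + 1)]

end BigJacobi

end

/-!
The substitution `y = (1 - x ^ 2) / (1 - c ^ 2)` reduces everything to Jacobi polynomials on `(0, 1)`.
Put `A = (a + 1) / 2` and `B = (b + 1) / 2`, and let `μ` be the measure with density
`y ^ (A - 1) * (1 - y) ^ (B - 1)`.

*Jacobi polynomials.* `hyp N (N + A + B - 1) A` is the polynomial `₂F₁(-N, N + A + B - 1; A; y)`. It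
solves the hypergeometric equation (`hyp_ode`), and integration by parts (`betaE_by_parts`) gives a
Green formula. Hence these polynomials are orthogonal for `μ`, the eigenvalues being distinct, and
since differentiation lowers `N` and raises `A` and `B` by one, their norms follow by induction from
the beta integral (`betaE_hyp_sq`).

*Orthogonality of `J n`.* Write `J n x = P y + (1 - x) / (1 + c) * Q y` (`J_eq`). Adding up the
contributions of `x` and `-x` turns both orthogonality functionals, for `|c| < 1` and for `|c| > 1`,
into integrals over `(0, 1)` (`integral_symmetric_weight`). On `J n * J m` the result is, up to a
constant, `∫ (P + y Q) (P' + y Q') + y (1 - y) Q Q' dμ`, where `P', Q'` are the components of `J m`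
(`bigInner`). By contiguous relations `P + y Q` is a Jacobi polynomial for `(A, B)`, and `Q` is a
multiple of one for `(A + 1, B + 1)`, of the same degrees for `n = 2 N + 1` and `n = 2 N + 2`. So the
two integrals vanish separately unless `n` and `m` share these degrees; for such a pair with `n ≠ m`
they cancel, and for `n = m` they add up to `h a b n`.

*Christoffel transform.* Since `J n 1 = 1`, the transform is `κ (n + 1) (J (n + 1) - J n) / (x - 1)`.
The contiguous relations evaluate this difference (`sub_one_mul_christoffel`) as a Jacobi polynomial
in `y`, times `x + c` when `n` is odd. The Chihara polynomials are Jacobi polynomials in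
`x ^ 2 - γ ^ 2`, times `x - γ` for odd degree (`chihara_even`, `chihara_odd`). After rescaling,
`x ^ 2 - γ ^ 2` becomes `1 - y`, so that the two families agree by the reflection formula
`jacobi_comp_one_sub`. Monicity of the transform is then visible, and that of the polynomials
`κ n * J n` follows by induction. The last two identities are linear algebra with a monic orthogonal
sequence (`functional_christoffel_mul`).

*Chihara polynomials.* Their weight folds to the beta weight with parameters `α + 1, β + 1`; the
products of two polynomials of odd degree carry a further factor `y`, and products of opposite parity
fold to zero (`integral_chihara_mul_chihara`).
-/

noncomputable section

namespace BigJacobi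

/-! ### Pochhammer symbols and terminating hypergeometric polynomials -/

section Poch

variable {𝕜 : Type*} [Field 𝕜]

@[simp] lemma poch_zero (t : 𝕜) : poch t 0 = 1 := by simp [poch]

lemma poch_succ (t : 𝕜) (k : ℕ) : poch t (k + 1) = poch t k * (t + k) := by
  simp [poch, ascPochhammer_succ_eval]

lemma poch_succ_left (t : 𝕜) (k : ℕ) : poch t (k + 1) = t * poch (t + 1) k := by
  simp [poch, ascPochhammer_succ_left, eval_comp]

lemma poch_neg_of_lt {N k : ℕ} (h : N < k) : poch (-(N : 𝕜)) k = 0 :=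
  ascPochhammer_eval_neg_coe_nat_of_lt h

lemma poch_pos {t : ℝ} (ht : 0 < t) (k : ℕ) : 0 < poch t k := ascPochhammer_pos k t ht

lemma poch_ne_zero {t : ℝ} (ht : 0 < t) (k : ℕ) : poch t k ≠ 0 := (poch_pos ht k).ne'

lemma poch_neg_self (N : ℕ) : poch (-(N : ℝ)) N = (-1) ^ N * (N ! : ℕ) := by
  induction N with
  | zero => simp
  | succ N ih =>
    rw [poch_succ_left, show -((N + 1 : ℕ) : ℝ) + 1 = -(N : ℝ) by push_cast; ring, ih,
      Nat.factorial_succ]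
    push_cast; ring

lemma poch_ofReal {𝕂 : Type*} [RCLike 𝕂] (t : ℝ) (k : ℕ) :
    poch (t : 𝕂) k = ((poch t k : ℝ) : 𝕂) := by
  induction k with
  | zero => simp
  | succ k ih => rw [poch_succ, poch_succ, ih]; push_cast; ring

lemma Gamma_add_nat {t : ℝ} (ht : 0 < t) (k : ℕ) :
    Real.Gamma (t + k) = poch t k * Real.Gamma t := by
  induction k with
  | zero => simp
  | succ k ih =>
    rw [show t + ((k + 1 : ℕ) : ℝ) = (t + k) + 1 by push_cast; ring,
      Real.Gamma_add_one (by positivity), ih, poch_succ]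
    ring

end Poch

/-- The terminating hypergeometric series `₂F₁(-N, s; A; ·)` as a polynomial. -/
def hyp (N : ℕ) (s A : ℝ) : ℝ[X] :=
  ∑ k ∈ Finset.range (N + 1),
    monomial k (poch (-(N : ℝ)) k * poch s k / (poch A k * (k ! : ℕ)))

lemma coeff_hyp (N : ℕ) (s A : ℝ) (k : ℕ) :
    (hyp N s A).coeff k = poch (-(N : ℝ)) k * poch s k / (poch A k * (k ! : ℕ)) := by
  rw [hyp, finsetSum_coeff]
  simp only [coeff_monomial, Finset.sum_ite_eq', Finset.mem_range]
  split_ifs with h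
  · rfl
  · rw [poch_neg_of_lt (by omega)]; simp

@[simp] lemma hyp_zero (s A : ℝ) : hyp 0 s A = 1 := by simp [hyp]

@[simp] lemma eval_zero_hyp (N : ℕ) (s A : ℝ) : (hyp N s A).eval 0 = 1 := by
  rw [← coeff_zero_eq_eval_zero, coeff_hyp]; simp

lemma natDegree_hyp_le (N : ℕ) (s A : ℝ) : (hyp N s A).natDegree ≤ N := by
  refine natDegree_le_iff_coeff_eq_zero.2 fun k hk => ?_
  rw [coeff_hyp, poch_neg_of_lt hk]; simp

/-- The analytic function `₂F₁` takes, at real arguments, the values of the polynomial `hyp`,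
over both the real and the complex numbers. -/
lemma hypergeometric_neg_nat {𝕜 : Type*} [RCLike 𝕜] (N : ℕ) (s A z : ℝ) :
    ₂F₁ (-(N : 𝕜)) (s : 𝕜) (A : 𝕜) (z : 𝕜) = (((hyp N s A).eval z : ℝ) : 𝕜) := by
  rw [ordinaryHypergeometric_eq_tsum]
  simp only
  rw [tsum_eq_sum (s := Finset.range (N + 1)), hyp, eval_finsetSum]
  · push_cast
    refine Finset.sum_congr rfl fun k _ => ?_
    simp only [eval_monomial, RCLike.ofReal_mul, RCLike.ofReal_div, RCLike.ofReal_pow,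
      RCLike.ofReal_natCast, ← poch_ofReal, RCLike.ofReal_neg]
    simp only [poch, smul_eq_mul, div_eq_mul_inv, mul_inv]
    ring
  · intro k hk
    rw [ascPochhammer_eval_neg_coe_nat_of_lt (by simpa using hk)]
    simp

lemma hypergeometric_neg_nat_real (N : ℕ) (s A z : ℝ) :
    ₂F₁ (-(N : ℝ)) s A z = (hyp N s A).eval z := by
  simpa using hypergeometric_neg_nat (𝕜 := ℝ) N s A z

lemma derivative_hyp (N : ℕ) (s : ℝ) {A : ℝ} (hA : 0 < A) :
    derivative (hyp (N + 1) s A) = C (-((N + 1) * s / A)) * hyp N (s + 1) (A + 1) := by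
  ext k
  have h1 := poch_ne_zero (t := A + 1) (by linarith) k
  rw [coeff_derivative, coeff_C_mul, coeff_hyp, coeff_hyp, poch_succ_left s, poch_succ_left A,
    poch_succ_left, Nat.factorial_succ]
  push_cast
  rw [show -((N : ℝ) + 1) + 1 = -N by ring]
  field_simp

/-- A contiguous relation; it turns the component `p + (1 + c) y q` of an even Big -1 Jacobi
polynomial into a Jacobi polynomial. -/
lemma hyp_contiguous_even (N : ℕ) (s : ℝ) {A : ℝ} (hA : 0 < A) :
    hyp (N + 1) (s + 1) A + C ((N + 1) / A) * (X * hyp N (s + 1) (A + 1)) = hyp (N + 1) s A := by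
  ext k
  rcases k with _ | k
  · simp [coeff_hyp]
  have h1 := poch_ne_zero (t := A + 1) (by linarith) k
  rw [coeff_add, coeff_C_mul, coeff_X_mul, coeff_hyp, coeff_hyp, coeff_hyp, poch_succ_left s,
    poch_succ_left A, poch_succ (s + 1), poch_succ_left (-((N + 1 : ℕ) : ℝ)), Nat.factorial_succ]
  push_cast
  rw [show -((N : ℝ) + 1) + 1 = -N by ring]
  field_simp
  ring

/-- A contiguous relation; it turns the component `p + (1 + c) y q` of an odd Big -1 Jacobi
polynomial into a Jacobi polynomial. -/
lemma hyp_contiguous_odd (N : ℕ) (s : ℝ) {A : ℝ} (hA : 0 < A) :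
    hyp N s A - C (s / A) * (X * hyp N (s + 1) (A + 1)) = hyp (N + 1) s A := by
  ext k
  rcases k with _ | k
  · simp [coeff_hyp]
  have h1 := poch_ne_zero (t := A + 1) (by linarith) k
  rw [coeff_sub, coeff_C_mul, coeff_X_mul, coeff_hyp, coeff_hyp, coeff_hyp, poch_succ_left s,
    poch_succ_left A, poch_succ (-(N : ℝ)), poch_succ_left (-((N + 1 : ℕ) : ℝ)), Nat.factorial_succ]
  push_cast
  rw [show -((N : ℝ) + 1) + 1 = -N by ring]
  field_simp
  ring

lemma hyp_contiguous_sum (N : ℕ) (s A : ℝ) :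
    C s * hyp (N + 1) (s + 1) A + C ((N : ℝ) + 1) * hyp N s A =
      C (s + N + 1) * hyp (N + 1) s A := by
  ext k
  have e1 : s * poch (s + 1) k = poch s k * (s + k) := by rw [← poch_succ_left, poch_succ]
  have e2 : (-((N + 1 : ℕ) : ℝ)) * poch (-(N : ℝ)) k =
      poch (-((N + 1 : ℕ) : ℝ)) k * (-((N + 1 : ℕ) : ℝ) + k) := by
    rw [← poch_succ, poch_succ_left]; push_cast; ring_nf
  simp only [coeff_add, coeff_C_mul, coeff_hyp]
  push_cast at e2 ⊢
  linear_combination (poch (-((N : ℝ) + 1)) k / (poch A k * (k ! : ℕ))) * e1 -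
    (poch s k / (poch A k * (k ! : ℕ))) * e2

/-! ### The hypergeometric differential equation and monic Jacobi polynomials -/

/-- A polynomial solution of the hypergeometric differential equation is determined by its constant
term, because `A > 0` makes its coefficients satisfy a first order recursion. -/
lemma eq_of_hypergeometric_ode {A : ℝ} (B r : ℝ) (hA : 0 < A) (f g : ℝ[X])
    (hf : X * (1 - X) * derivative (derivative f) + (C A - C (A + B) * X) * derivative f +
      C r * f = 0)
    (hg : X * (1 - X) * derivative (derivative g) + (C A - C (A + B) * X) * derivative g +
      C r * g = 0) (h0 : f.coeff 0 = g.coeff 0) : f = g := by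
  have key : ∀ f : ℝ[X], X * (1 - X) * derivative (derivative f) +
      (C A - C (A + B) * X) * derivative f + C r * f = 0 → ∀ k : ℕ,
      (k + 1) * (k + A) * f.coeff (k + 1) = (k * (k - 1 + A + B) - r) * f.coeff k := by
    intro f hf k
    have h := congrArg (fun p => p.coeff k) hf
    rw [show X * (1 - X) * derivative (derivative f) + (C A - C (A + B) * X) * derivative f +
      C r * f = X * derivative (derivative f) - X * (X * derivative (derivative f)) +
        C A * derivative f - C (A + B) * (X * derivative f) + C r * f by ring] at h
    rcases k with _ | _ | k <;>
      simp only [coeff_add, coeff_sub, coeff_C_mul, coeff_X_mul, coeff_X_mul_zero,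
        coeff_derivative, coeff_zero] at h <;> push_cast at h ⊢ <;> linear_combination h
  ext k
  induction k with
  | zero => exact h0
  | succ k ih =>
    have h1 := key f hf k
    rw [ih, ← key g hg k] at h1
    exact mul_left_cancel₀ (by positivity) h1

lemma hyp_ode (N : ℕ) {A : ℝ} (B : ℝ) (hA : 0 < A) :
    X * (1 - X) * derivative (derivative (hyp N (N + A + B - 1) A)) +
      (C A - C (A + B) * X) * derivative (hyp N (N + A + B - 1) A) +
      C (N * (N + A + B - 1)) * hyp N (N + A + B - 1) A = 0 := by
  set f := hyp N (N + A + B - 1) A with hf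
  have key : ∀ k : ℕ, (k + 1) * (k + A) * f.coeff (k + 1) =
      (k * (k - 1 + A + B) - N * (N + A + B - 1)) * f.coeff k := by
    intro k
    have h1 := poch_ne_zero hA k
    rw [hf, coeff_hyp, coeff_hyp, poch_succ, poch_succ, poch_succ, Nat.factorial_succ]
    push_cast
    have : A + k ≠ 0 := by positivity
    field_simp
    ring
  ext k
  rw [show X * (1 - X) * derivative (derivative f) + (C A - C (A + B) * X) * derivative f +
      C (N * (N + A + B - 1)) * f = X * derivative (derivative f) -
      X * (X * derivative (derivative f)) + C A * derivative f - C (A + B) * (X * derivative f) +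
      C (N * (N + A + B - 1)) * f by ring]
  have := key k
  rcases k with _ | _ | k <;>
    simp only [coeff_add, coeff_sub, coeff_C_mul, coeff_X_mul, coeff_X_mul_zero,
      coeff_derivative, coeff_zero] <;> push_cast at this ⊢ <;> linear_combination this

/-- The monic Jacobi polynomial of degree `N` for the weight `y ^ (A - 1) * (1 - y) ^ (B - 1)` on
`(0, 1)`. -/
def jacobi (N : ℕ) (A B : ℝ) : ℝ[X] :=
  C ((-1) ^ N * (poch A N / poch (N + A + B - 1) N)) * hyp N (N + A + B - 1) A

lemma poch_jacobi_ne_zero (N : ℕ) {A B : ℝ} (hA : 0 < A) (hB : 0 < B) :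
    poch (N + A + B - 1) N ≠ 0 := by
  rcases N with _ | N
  · simp
  · refine poch_ne_zero ?_ _
    push_cast
    have : (0 : ℝ) ≤ N := N.cast_nonneg
    linarith

lemma coeff_jacobi_self (N : ℕ) {A B : ℝ} (hA : 0 < A) (hB : 0 < B) :
    (jacobi N A B).coeff N = 1 := by
  have h1 := poch_ne_zero hA N
  have h2 := poch_jacobi_ne_zero N hA hB
  rw [jacobi, coeff_C_mul, coeff_hyp, poch_neg_self]
  field_simp
  rw [← pow_mul, mul_comm, pow_mul]; simp

lemma natDegree_jacobi_le (N : ℕ) (A B : ℝ) : (jacobi N A B).natDegree ≤ N :=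
  (natDegree_C_mul_le _ _).trans (natDegree_hyp_le _ _ _)

lemma natDegree_jacobi (N : ℕ) {A B : ℝ} (hA : 0 < A) (hB : 0 < B) :
    (jacobi N A B).natDegree = N :=
  le_antisymm (natDegree_jacobi_le N A B)
    (le_natDegree_of_ne_zero (by rw [coeff_jacobi_self N hA hB]; exact one_ne_zero))

lemma monic_jacobi (N : ℕ) {A B : ℝ} (hA : 0 < A) (hB : 0 < B) : (jacobi N A B).Monic := by
  rw [Monic, leadingCoeff, natDegree_jacobi N hA hB, coeff_jacobi_self N hA hB]

/-- The reflection `y ↦ 1 - y` exchanges the two parameters of a Jacobi polynomial: both sides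
solve the same differential equation and have the same leading coefficient. -/
lemma jacobi_comp_one_sub (N : ℕ) {A B : ℝ} (hA : 0 < A) (hB : 0 < B) :
    (jacobi N B A).comp (1 - X) = C ((-1) ^ N) * jacobi N A B := by
  set f := (jacobi N B A).comp (1 - X) with hf
  have hq : (1 - X : ℝ[X]).natDegree = 1 := by
    rw [← neg_sub, natDegree_neg, ← C_1, natDegree_X_sub_C]
  have hlq : (1 - X : ℝ[X]).leadingCoeff = -1 := by
    rw [← neg_sub, leadingCoeff_neg, ← C_1, leadingCoeff_X_sub_C]
  have hfN : f.coeff N = (-1) ^ N := by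
    have h1 : f.natDegree = N := by rw [hf, natDegree_comp, hq, natDegree_jacobi N hB hA, mul_one]
    have h2 : f.leadingCoeff = (-1) ^ N := by
      rw [hf, leadingCoeff_comp (by rw [hq]; exact one_ne_zero), (monic_jacobi N hB hA), hlq,
        natDegree_jacobi N hB hA, one_mul]
    rwa [leadingCoeff, h1] at h2
  have hode : X * (1 - X) * derivative (derivative f) + (C A - C (A + B) * X) * derivative f +
      C (N * (N + A + B - 1)) * f = 0 := by
    have h := congrArg (fun p => (C ((-1) ^ N * (poch B N / poch (N + B + A - 1) N)) * p).comp
      (1 - X)) (hyp_ode N A hB)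
    simp only [hf, jacobi, derivative_comp, derivative_sub, derivative_one, derivative_X,
      derivative_mul, derivative_C, derivative_neg, mul_comp, C_comp, add_comp, sub_comp, X_comp,
      one_comp, zero_comp, mul_zero, zero_mul, zero_add, zero_sub, mul_neg, neg_mul,
      C_add, C_mul, C_sub] at h ⊢
    linear_combination h
  have hfe : f = C (f.coeff 0) * hyp N (N + A + B - 1) A := by
    refine eq_of_hypergeometric_ode B (N * (N + A + B - 1)) hA _ _ hode ?_ ?_
    · have h := congrArg (fun p => C (f.coeff 0) * p) (hyp_ode N B hA)
      simp only [derivative_mul, derivative_C, zero_mul, zero_add, mul_zero] at h ⊢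
      linear_combination h
    · rw [coeff_C_mul, coeff_zero_eq_eval_zero (hyp _ _ _), eval_zero_hyp, mul_one]
  have hc : ∃ r : ℝ, f = C r * jacobi N A B := by
    refine ⟨f.coeff 0 * ((-1) ^ N * (poch A N / poch (N + A + B - 1) N))⁻¹, ?_⟩
    rw [jacobi, ← mul_assoc, ← C_mul, mul_assoc, inv_mul_cancel₀, mul_one]
    · exact hfe
    · exact mul_ne_zero (pow_ne_zero _ (by norm_num))
        (div_ne_zero (poch_ne_zero hA N) (poch_jacobi_ne_zero N hA hB))
  obtain ⟨r, hr⟩ := hc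
  have : r = (-1) ^ N := by
    rw [← hfN, hr, coeff_C_mul, coeff_jacobi_self N hA hB, mul_one]
  rw [hr, this]

/-! ### The beta functional and the orthogonality of the Jacobi polynomials -/

/-- The density `y ^ (A - 1) * (1 - y) ^ (B - 1)` of the (unnormalized) beta distribution. -/
def betaWeight (A B y : ℝ) : ℝ := y ^ (A - 1) * (1 - y) ^ (B - 1)

lemma integrableOn_betaWeight {A B : ℝ} (hA : 0 < A) (hB : 0 < B) :
    IntegrableOn (betaWeight A B) (Set.Ioo 0 1) := by
  have h := (Complex.betaIntegral_convergent (u := A) (v := B) (by simpa) (by simpa))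
  rw [intervalIntegrable_iff_integrableOn_Ioo_of_le zero_le_one] at h
  refine (Integrable.re h).congr ?_
  filter_upwards [ae_restrict_mem measurableSet_Ioo] with x hx
  norm_cast
  rw [← Complex.ofReal_cpow hx.1.le, ← Complex.ofReal_cpow (by linarith [hx.2])]
  norm_cast

lemma integral_betaWeight {A B : ℝ} (hA : 0 < A) (hB : 0 < B) :
    ∫ y in Set.Ioo 0 1, betaWeight A B y =
      Real.Gamma A * Real.Gamma B / Real.Gamma (A + B) := by
  have h := (Complex.betaIntegral_convergent (u := A) (v := B) (by simpa) (by simpa))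
  rw [intervalIntegrable_iff_integrableOn_Ioo_of_le zero_le_one] at h
  change _ = ProbabilityTheory.beta A B
  rw [ProbabilityTheory.beta_eq_betaIntegralReal A B hA hB, Complex.betaIntegral,
    intervalIntegral.integral_of_le zero_le_one, integral_Ioc_eq_integral_Ioo,
    ← RCLike.re_to_complex, ← integral_re h]
  refine setIntegral_congr_fun measurableSet_Ioo fun x hx => ?_
  norm_cast
  rw [← Complex.ofReal_cpow hx.1.le, ← Complex.ofReal_cpow (by linarith [hx.2])]
  norm_cast

lemma integrableOn_mul_betaWeight {A B : ℝ} (hA : 0 < A) (hB : 0 < B) {f : ℝ → ℝ}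
    (hf : Continuous f) : IntegrableOn (fun y => f y * betaWeight A B y) (Set.Ioo 0 1) := by
  have h := integrableOn_betaWeight hA hB
  rw [← integrableOn_Icc_iff_integrableOn_Ioo] at h ⊢
  exact h.continuousOn_mul hf.continuousOn isCompact_Icc

/-- Integration of a polynomial against the beta weight. -/
def betaE (A B : ℝ) (p : ℝ[X]) : ℝ := ∫ y in Set.Ioo 0 1, p.eval y * betaWeight A B y

lemma betaE_add {A B : ℝ} (hA : 0 < A) (hB : 0 < B) (p q : ℝ[X]) :
    betaE A B (p + q) = betaE A B p + betaE A B q := by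
  rw [betaE, betaE, betaE, ← integral_add (integrableOn_mul_betaWeight hA hB p.continuous)
    (integrableOn_mul_betaWeight hA hB q.continuous)]
  simp only [eval_add, add_mul]

lemma betaE_C_mul (A B r : ℝ) (p : ℝ[X]) : betaE A B (C r * p) = r * betaE A B p := by
  rw [betaE, betaE, ← integral_const_mul]
  simp only [eval_mul, eval_C, mul_assoc]

lemma betaE_X_mul (A B : ℝ) (p : ℝ[X]) : betaE A B (X * p) = betaE (A + 1) B p := by
  refine setIntegral_congr_fun measurableSet_Ioo fun y hy => ?_
  simp only [betaWeight, eval_mul, eval_X]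
  rw [show A + 1 - 1 = (A - 1) + 1 by ring, Real.rpow_add_one hy.1.ne']
  ring

lemma betaE_one_sub_X_mul (A B : ℝ) (p : ℝ[X]) :
    betaE A B ((1 - X) * p) = betaE A (B + 1) p := by
  refine setIntegral_congr_fun measurableSet_Ioo fun y hy => ?_
  simp only [betaWeight, eval_mul, eval_X, eval_sub, eval_one]
  rw [show B + 1 - 1 = (B - 1) + 1 by ring, Real.rpow_add_one (by linarith [hy.2])]
  ring

lemma betaE_one {A B : ℝ} (hA : 0 < A) (hB : 0 < B) :
    betaE A B 1 = Real.Gamma A * Real.Gamma B / Real.Gamma (A + B) := by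
  simpa [betaE] using integral_betaWeight hA hB

/-- The integral over `(0, 1)` of the derivative of `y ^ A * (1 - y) ^ B * g y` is zero. -/
lemma betaE_by_parts {A B : ℝ} (hA : 0 < A) (hB : 0 < B) (g : ℝ[X]) :
    betaE A B ((C A - C (A + B) * X) * g + X * (1 - X) * derivative g) = 0 := by
  have hder : ∀ y ∈ Set.Ioo (0 : ℝ) 1, HasDerivAt (fun y => y ^ A * (1 - y) ^ B * g.eval y)
      (((C A - C (A + B) * X) * g + X * (1 - X) * derivative g).eval y * betaWeight A B y) y := by
    intro y hy
    have hy' : 0 < 1 - y := by linarith [hy.2]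
    have h1 := Real.hasDerivAt_rpow_const (x := y) (p := A) (Or.inl hy.1.ne')
    have h2 := (Real.hasDerivAt_rpow_const (x := 1 - y) (p := B) (Or.inl hy'.ne')).comp y
      ((hasDerivAt_id y).const_sub 1)
    refine ((h1.mul h2).mul (g.hasDerivAt y)).congr_deriv ?_
    simp only [eval_mul, eval_add, eval_sub, eval_C, eval_X, eval_one, betaWeight, Function.comp,
      Pi.mul_apply]
    have e1 : y ^ A = y ^ (A - 1) * y := by
      rw [← Real.rpow_add_one hy.1.ne']; ring_nf
    have e2 : (1 - y) ^ B = (1 - y) ^ (B - 1) * (1 - y) := by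
      rw [← Real.rpow_add_one hy'.ne']; ring_nf
    rw [e1, e2]
    ring
  have hcont : Continuous (fun y : ℝ => y ^ A * (1 - y) ^ B * g.eval y) :=
    ((Real.continuous_rpow_const hA.le).mul
      ((Real.continuous_rpow_const hB.le).comp (continuous_const.sub continuous_id))).mul
      g.continuous
  have h := intervalIntegral.integral_eq_sub_of_hasDerivAt_of_le zero_le_one hcont.continuousOn
    hder ((intervalIntegrable_iff_integrableOn_Ioo_of_le zero_le_one).2
      (integrableOn_mul_betaWeight hA hB (Polynomial.continuous _)))
  rw [intervalIntegral.integral_of_le zero_le_one, integral_Ioc_eq_integral_Ioo] at h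
  rw [betaE, h]
  simp [Real.zero_rpow hA.ne', Real.zero_rpow hB.ne']

/-- Green's formula: the hypergeometric differential operator is minus the composition of the
derivative with its adjoint. -/
lemma betaE_derivative_mul_derivative {A B r : ℝ} (hA : 0 < A) (hB : 0 < B) (f g : ℝ[X])
    (hf : X * (1 - X) * derivative (derivative f) + (C A - C (A + B) * X) * derivative f +
      C r * f = 0) :
    betaE (A + 1) (B + 1) (derivative f * derivative g) = r * betaE A B (f * g) := by
  have h := betaE_by_parts hA hB (derivative f * g)
  have e : (C A - C (A + B) * X) * (derivative f * g) +
      X * (1 - X) * derivative (derivative f * g) =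
      X * ((1 - X) * (derivative f * derivative g)) + C (-r) * (f * g) := by
    rw [derivative_mul, C_neg]
    linear_combination g * hf
  rw [e, betaE_add hA hB, betaE_C_mul, betaE_X_mul, betaE_one_sub_X_mul] at h
  linear_combination h

/-- The eigenvalues of the differential operator are distinct, so its eigenfunctions are
orthogonal. -/
lemma betaE_hyp_mul_hyp_of_ne {A B : ℝ} (hA : 0 < A) (hB : 0 < B) {N M : ℕ} (h : N ≠ M) :
    betaE A B (hyp N (N + A + B - 1) A * hyp M (M + A + B - 1) A) = 0 := by
  have h1 := betaE_derivative_mul_derivative hA hB _ (hyp M (M + A + B - 1) A) (hyp_ode N B hA)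
  have h2 := betaE_derivative_mul_derivative hA hB _ (hyp N (N + A + B - 1) A) (hyp_ode M B hA)
  rw [mul_comm (derivative _), h1, mul_comm (hyp M _ _)] at h2
  -- the difference of the eigenvalues `N (N + A + B - 1)` and `M (M + A + B - 1)`
  have h3 : ((N : ℝ) - M) * (N + M + A + B - 1) ≠ 0 := by
    refine mul_ne_zero (sub_ne_zero.2 (by exact_mod_cast h)) ?_
    have : (1 : ℝ) ≤ N + M := by
      have : 1 ≤ N + M := by omega
      exact_mod_cast this
    exact (by linarith : (0 : ℝ) < N + M + A + B - 1).ne'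
  refine (mul_eq_zero.1 (?_ : ((N : ℝ) - M) * (N + M + A + B - 1) * _ = 0)).resolve_left h3
  linear_combination h2

/-- Green's formula for `f = g`: the derivative of a Jacobi polynomial for `(A, B)` is a multiple of
one for `(A + 1, B + 1)`. -/
lemma betaE_hyp_sq_succ {A B : ℝ} (hA : 0 < A) (hB : 0 < B) (N : ℕ) :
    betaE A B (hyp (N + 1) (N + A + B) A * hyp (N + 1) (N + A + B) A) =
      (N + 1) * (N + A + B) / A ^ 2 *
        betaE (A + 1) (B + 1) (hyp N (N + A + B + 1) (A + 1) * hyp N (N + A + B + 1) (A + 1)) := by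
  have hpos : (0 : ℝ) < N + A + B := by positivity
  have h1 := betaE_derivative_mul_derivative hA hB _ (hyp (N + 1) ((N + 1 : ℕ) + A + B - 1) A)
    (hyp_ode (N + 1) B hA)
  rw [show ((N + 1 : ℕ) : ℝ) + A + B - 1 = N + A + B by push_cast; ring] at h1
  rw [derivative_hyp N _ hA, mul_mul_mul_comm, ← C_mul, betaE_C_mul] at h1
  push_cast at h1
  have h2 : ((N : ℝ) + 1) * (N + A + B) ≠ 0 := by positivity
  refine mul_left_cancel₀ h2 ?_
  rw [← h1]
  field_simp

lemma betaE_hyp_sq {A B : ℝ} (hA : 0 < A) (hB : 0 < B) (N : ℕ) :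
    betaE A B (hyp N (N + A + B - 1) A * hyp N (N + A + B - 1) A) =
      (N ! : ℕ) * poch (N + A + B - 1) N * Real.Gamma (A + N) * Real.Gamma (B + N) /
        (poch A N ^ 2 * Real.Gamma (A + B + 2 * N)) := by
  induction N generalizing A B with
  | zero => simp [betaE_one hA hB]
  | succ N ih =>
    have h1 := betaE_hyp_sq_succ hA hB N
    have h2 := ih (A := A + 1) (B := B + 1) (by linarith) (by linarith)
    rw [show (N : ℝ) + (A + 1) + (B + 1) - 1 = N + A + B + 1 by ring] at h2
    rw [show ((N + 1 : ℕ) : ℝ) + A + B - 1 = N + A + B by push_cast; ring, h1, h2,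
      poch_succ_left, poch_succ_left A, Nat.factorial_succ]
    push_cast
    rw [show A + 1 + (N : ℝ) = A + (N + 1) by ring, show B + 1 + (N : ℝ) = B + (N + 1) by ring,
      show A + 1 + (B + 1) + 2 * (N : ℝ) = A + B + 2 * (N + 1) by ring]
    have := poch_ne_zero (t := A + 1) (by linarith) N
    have := (Real.Gamma_pos_of_pos (s := A + B + 2 * (N + 1)) (by positivity)).ne'
    field_simp

lemma betaE_jacobi_mul_jacobi_of_ne {A B : ℝ} (hA : 0 < A) (hB : 0 < B) {N M : ℕ} (h : N ≠ M) :
    betaE A B (jacobi N A B * jacobi M A B) = 0 := by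
  rw [jacobi, jacobi, mul_mul_mul_comm, ← C_mul, betaE_C_mul, betaE_hyp_mul_hyp_of_ne hA hB h,
    mul_zero]

lemma betaE_jacobi_sq {A B : ℝ} (hA : 0 < A) (hB : 0 < B) (N : ℕ) :
    betaE A B (jacobi N A B * jacobi N A B) =
      (N ! : ℕ) * Real.Gamma (A + N) * Real.Gamma (B + N) /
        (poch (N + A + B - 1) N * Real.Gamma (A + B + 2 * N)) := by
  have h1 := poch_ne_zero hA N
  have h2 := poch_jacobi_ne_zero N hA hB
  have h3 := (Real.Gamma_pos_of_pos (s := A + B + 2 * N) (by positivity)).ne'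
  rw [jacobi, mul_mul_mul_comm, ← C_mul, betaE_C_mul, betaE_hyp_sq hA hB]
  field_simp
  rw [← pow_mul, mul_comm, pow_mul]; simp

/-! ### Folding integrals over a symmetric pair of intervals -/

section Fold

variable {r₀ r₁ : ℝ}

/-- The change of variables `t = (x ^ 2 - r₀ ^ 2) / (r₁ ^ 2 - r₀ ^ 2)`. -/
lemma image_fold (h0 : 0 ≤ r₀) (h1 : r₀ < r₁) :
    (fun x => (x ^ 2 - r₀ ^ 2) / (r₁ ^ 2 - r₀ ^ 2)) '' Set.Ioo r₀ r₁ = Set.Ioo (0 : ℝ) 1 := by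
  have hΔ : 0 < r₁ ^ 2 - r₀ ^ 2 := by nlinarith
  ext t
  constructor
  · rintro ⟨x, hx, rfl⟩
    exact ⟨div_pos (by nlinarith [hx.1, hx.2]) hΔ, (div_lt_one hΔ).2 (by nlinarith [hx.1, hx.2])⟩
  · intro ht
    have h2 : 0 < t * (r₁ ^ 2 - r₀ ^ 2) := mul_pos ht.1 hΔ
    have h3 : t * (r₁ ^ 2 - r₀ ^ 2) < r₁ ^ 2 - r₀ ^ 2 := by nlinarith [ht.2]
    refine ⟨√(r₀ ^ 2 + t * (r₁ ^ 2 - r₀ ^ 2)), ⟨?_, ?_⟩, ?_⟩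
    · exact Real.lt_sqrt_of_sq_lt (by linarith)
    · exact (Real.sqrt_lt' (by linarith)).2 (by linarith)
    · simp only
      rw [Real.sq_sqrt (by positivity)]
      field_simp
      ring

lemma injOn_fold (h0 : 0 ≤ r₀) (h1 : r₀ < r₁) :
    Set.InjOn (fun x => (x ^ 2 - r₀ ^ 2) / (r₁ ^ 2 - r₀ ^ 2)) (Set.Ioo r₀ r₁) := by
  have hΔ : 0 < r₁ ^ 2 - r₀ ^ 2 := by nlinarith
  intro x hx z hz hxz
  simp only at hxz
  rw [div_left_inj' hΔ.ne', sub_left_inj] at hxz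
  exact (pow_left_inj₀ (h0.trans hx.1.le) (h0.trans hz.1.le) two_ne_zero).1 hxz

lemma hasDerivWithinAt_fold (r₀ r₁ x : ℝ) (s : Set ℝ) :
    HasDerivWithinAt (fun x => (x ^ 2 - r₀ ^ 2) / (r₁ ^ 2 - r₀ ^ 2))
      (2 * x / (r₁ ^ 2 - r₀ ^ 2)) s x := by
  have := (((hasDerivAt_pow 2 x).sub_const (r₀ ^ 2)).div_const (r₁ ^ 2 - r₀ ^ 2))
  simpa using this.hasDerivWithinAt

lemma integrableOn_fold {g : ℝ → ℝ} (h0 : 0 ≤ r₀) (h1 : r₀ < r₁)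
    (hg : IntegrableOn g (Set.Ioo 0 1)) :
    IntegrableOn (fun x => x * g ((x ^ 2 - r₀ ^ 2) / (r₁ ^ 2 - r₀ ^ 2))) (Set.Ioo r₀ r₁) := by
  have hΔ : 0 < r₁ ^ 2 - r₀ ^ 2 := by nlinarith
  rw [← image_fold h0 h1, integrableOn_image_iff_integrableOn_abs_deriv_smul measurableSet_Ioo
    (fun x _ => hasDerivWithinAt_fold r₀ r₁ x _) (injOn_fold h0 h1)] at hg
  refine (hg.const_mul ((r₁ ^ 2 - r₀ ^ 2) / 2)).congr ?_
  filter_upwards [ae_restrict_mem measurableSet_Ioo] with x hx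
  have hx0 : 0 < x := h0.trans_lt hx.1
  rw [abs_of_pos (by positivity), smul_eq_mul]
  field_simp

lemma integral_fold (h0 : 0 ≤ r₀) (h1 : r₀ < r₁) (g : ℝ → ℝ) :
    ∫ x in Set.Ioo r₀ r₁, 2 * x * g ((x ^ 2 - r₀ ^ 2) / (r₁ ^ 2 - r₀ ^ 2)) =
      (r₁ ^ 2 - r₀ ^ 2) * ∫ t in Set.Ioo 0 1, g t := by
  have hΔ : 0 < r₁ ^ 2 - r₀ ^ 2 := by nlinarith
  rw [← image_fold h0 h1, integral_image_eq_integral_abs_deriv_smul measurableSet_Ioo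
    (fun x _ => hasDerivWithinAt_fold r₀ r₁ x _) (injOn_fold h0 h1), ← integral_const_mul]
  refine setIntegral_congr_fun measurableSet_Ioo fun x hx => ?_
  have hx0 : 0 < x := h0.trans_lt hx.1
  rw [abs_of_pos (by positivity), smul_eq_mul]
  field_simp

/-- If `l` vanishes at the origin at least linearly, it compensates the Jacobian of the folding,
which degenerates when `r₀ = 0`. -/
lemma integrableOn_mul_fold {g f l : ℝ → ℝ} {M : ℝ} (h0 : 0 ≤ r₀) (h1 : r₀ < r₁)
    (hg : IntegrableOn g (Set.Ioo 0 1)) (hf : Continuous f) (hl : Continuous l)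
    (hM : ∀ x ∈ Set.Ioo r₀ r₁, |l x| ≤ M * x) :
    IntegrableOn (fun x => f x * l x * g ((x ^ 2 - r₀ ^ 2) / (r₁ ^ 2 - r₀ ^ 2)))
      (Set.Ioo r₀ r₁) := by
  have h2 : IntegrableOn (fun x => l x / x * (x * g ((x ^ 2 - r₀ ^ 2) / (r₁ ^ 2 - r₀ ^ 2))))
      (Set.Ioo r₀ r₁) := by
    refine Integrable.bdd_mul (c := M) (integrableOn_fold h0 h1 hg) ?_ ?_
    · exact (hl.measurable.div measurable_id).aestronglyMeasurable
    · filter_upwards [ae_restrict_mem measurableSet_Ioo] with x hx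
      have hx0 : 0 < x := h0.trans_lt hx.1
      rw [Real.norm_eq_abs, abs_div, abs_of_pos hx0, div_le_iff₀ hx0]
      exact hM x hx
  rw [← integrableOn_Icc_iff_integrableOn_Ioo] at h2
  have h3 := h2.continuousOn_mul hf.continuousOn isCompact_Icc
  rw [integrableOn_Icc_iff_integrableOn_Ioo] at h3
  refine h3.congr ?_
  filter_upwards [ae_restrict_mem measurableSet_Ioo] with x hx
  have hx0 : 0 < x := h0.trans_lt hx.1
  field_simp

/-- Integrability and folding of an integral over `[-r₁, -r₀] ∪ [r₀, r₁]`. -/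
lemma integral_union_neg {F : ℝ → ℝ} (h0 : 0 ≤ r₀) (h1 : r₀ < r₁)
    (hF : IntegrableOn F (Set.Ioo r₀ r₁)) (hF' : IntegrableOn (fun x => F (-x)) (Set.Ioo r₀ r₁)) :
    IntegrableOn F (Set.Icc (-r₁) (-r₀) ∪ Set.Icc r₀ r₁) ∧
      ∫ x in Set.Icc (-r₁) (-r₀) ∪ Set.Icc r₀ r₁, F x =
        ∫ x in Set.Ioo r₀ r₁, (F x + F (-x)) := by
  have hR : IntegrableOn F (Set.Icc r₀ r₁) := by rwa [integrableOn_Icc_iff_integrableOn_Ioo]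
  have hL : IntegrableOn F (Set.Icc (-r₁) (-r₀)) := by
    rw [integrableOn_Icc_iff_integrableOn_Ioo,
      ← intervalIntegrable_iff_integrableOn_Ioo_of_le (by linarith),
      IntervalIntegrable.iff_comp_neg, neg_neg, neg_neg]
    exact ((intervalIntegrable_iff_integrableOn_Ioo_of_le h1.le).2 hF').symm
  refine ⟨hL.union hR, ?_⟩
  -- the two intervals share the point `0` when `r₀ = 0`
  have hd : AEDisjoint volume (Set.Icc (-r₁) (-r₀)) (Set.Icc r₀ r₁) := by
    refine measure_mono_null (t := {0}) ?_ (by simp)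
    rintro x ⟨hx, hx'⟩
    have h3 := hx.2
    have h4 := hx'.1
    exact le_antisymm (by linarith) (by linarith)
  rw [setIntegral_union₀ hd measurableSet_Icc.nullMeasurableSet hL hR, integral_add hF hF',
    integral_Icc_eq_integral_Ioo, integral_Icc_eq_integral_Ioo, add_comm,
    ← integral_Ioc_eq_integral_Ioo, ← integral_Ioc_eq_integral_Ioo,
    ← integral_Ioc_eq_integral_Ioo, ← intervalIntegral.integral_of_le h1.le,
    ← intervalIntegral.integral_of_le h1.le, ← intervalIntegral.integral_of_le (by linarith),
    intervalIntegral.integral_comp_neg]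

/-- Folding for a weight of the form `sign x * l x * g t` on `[-r₁, -r₀] ∪ [r₀, r₁]`, where `t` is the
folded variable: only the odd part `2 * x * H t` of `f * l` contributes. -/
lemma integral_symmetric_weight {g f l W H : ℝ → ℝ} {M : ℝ} (h0 : 0 ≤ r₀) (h1 : r₀ < r₁)
    (hg : IntegrableOn g (Set.Ioo 0 1)) (hf : Continuous f) (hl : Continuous l)
    (hM : ∀ x, r₀ < |x| → |x| < r₁ → |l x| ≤ M * |x|)
    (hW : ∀ x, r₀ < |x| → |x| < r₁ →
      W x = Real.sign x * l x * g ((x ^ 2 - r₀ ^ 2) / (r₁ ^ 2 - r₀ ^ 2))) :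
    IntegrableOn (fun x => f x * W x) (Set.Icc (-r₁) (-r₀) ∪ Set.Icc r₀ r₁) ∧
      ((∀ x ∈ Set.Ioo r₀ r₁, f x * l x - f (-x) * l (-x) =
          2 * x * H ((x ^ 2 - r₀ ^ 2) / (r₁ ^ 2 - r₀ ^ 2))) →
        ∫ x in Set.Icc (-r₁) (-r₀) ∪ Set.Icc r₀ r₁, f x * W x =
          (r₁ ^ 2 - r₀ ^ 2) * ∫ t in Set.Ioo 0 1, H t * g t) := by
  have hpos : ∀ x ∈ Set.Ioo r₀ r₁, f x * l x * g ((x ^ 2 - r₀ ^ 2) / (r₁ ^ 2 - r₀ ^ 2)) =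
      f x * W x := by
    intro x hx
    have hx0 : 0 < x := h0.trans_lt hx.1
    rw [hW x (by rw [abs_of_pos hx0]; exact hx.1) (by rw [abs_of_pos hx0]; exact hx.2),
      Real.sign_of_pos hx0]
    ring
  have hneg : ∀ x ∈ Set.Ioo r₀ r₁,
      (-f (-x)) * l (-x) * g ((x ^ 2 - r₀ ^ 2) / (r₁ ^ 2 - r₀ ^ 2)) = f (-x) * W (-x) := by
    intro x hx
    have hx0 : 0 < x := h0.trans_lt hx.1
    rw [hW (-x) (by rw [abs_neg, abs_of_pos hx0]; exact hx.1)
      (by rw [abs_neg, abs_of_pos hx0]; exact hx.2), Real.sign_of_neg (by linarith), neg_sq]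
    ring
  have hiR : IntegrableOn (fun x => f x * W x) (Set.Ioo r₀ r₁) := by
    refine (integrableOn_mul_fold (M := M) h0 h1 hg hf hl fun x hx => ?_).congr_fun hpos
      measurableSet_Ioo
    have hx0 : 0 < x := h0.trans_lt hx.1
    have := hM x (by rw [abs_of_pos hx0]; exact hx.1) (by rw [abs_of_pos hx0]; exact hx.2)
    rwa [abs_of_pos hx0] at this
  have hiL : IntegrableOn (fun x => f (-x) * W (-x)) (Set.Ioo r₀ r₁) := by
    refine (integrableOn_mul_fold (M := M) h0 h1 hg (hf.comp continuous_neg).neg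
      (hl.comp continuous_neg) fun x hx => ?_).congr_fun hneg measurableSet_Ioo
    have hx0 : 0 < x := h0.trans_lt hx.1
    have := hM (-x) (by rw [abs_neg, abs_of_pos hx0]; exact hx.1)
      (by rw [abs_neg, abs_of_pos hx0]; exact hx.2)
    rwa [abs_neg, abs_of_pos hx0] at this
  obtain ⟨hi, he⟩ := integral_union_neg (F := fun x => f x * W x) h0 h1 hiR hiL
  refine ⟨hi, fun hH => ?_⟩
  rw [he, ← integral_fold h0 h1]
  refine setIntegral_congr_fun measurableSet_Ioo fun x hx => ?_
  rw [← hpos x hx, ← hneg x hx]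
  linear_combination g ((x ^ 2 - r₀ ^ 2) / (r₁ ^ 2 - r₀ ^ 2)) * hH x hx

end Fold

lemma rpow_mul_rpow_eq_betaWeight {u v d A B : ℝ} (hu : 0 ≤ u) (hd : 0 < d) (hv : 0 ≤ v)
    (huv : u + v = d) :
    u ^ (A - 1) * v ^ (B - 1) = d ^ (A + B - 2) * betaWeight A B (u / d) := by
  have h1 : 1 - u / d = v / d := by field_simp; linarith
  have h2 := (Real.rpow_pos_of_pos hd (A - 1)).ne'
  have h3 := (Real.rpow_pos_of_pos hd (B - 1)).ne'
  rw [betaWeight, h1, Real.div_rpow hu hd.le, Real.div_rpow hv hd.le,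
    show A + B - 2 = (A - 1) + (B - 1) by ring, Real.rpow_add hd]
  field_simp

lemma integral_comp_one_sub_mul_betaWeight (A B : ℝ) (f : ℝ → ℝ) :
    ∫ t in Set.Ioo 0 1, f (1 - t) * betaWeight B A t =
      ∫ t in Set.Ioo 0 1, f t * betaWeight A B t := by
  rw [← integral_Ioc_eq_integral_Ioo, ← integral_Ioc_eq_integral_Ioo,
    ← intervalIntegral.integral_of_le zero_le_one, ← intervalIntegral.integral_of_le zero_le_one]
  have h := intervalIntegral.integral_comp_sub_left (a := 0) (b := 1)
    (fun t => f t * betaWeight A B t) 1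
  rw [sub_self, sub_zero] at h
  rw [← h]
  refine intervalIntegral.integral_congr fun t _ => ?_
  simp only [betaWeight]
  rw [sub_sub_cancel]
  ring

lemma sq_lt_one_of_abs {c : ℝ} (hc : |c| < 1) : c ^ 2 < 1 := (sq_lt_one_iff_abs_lt_one c).2 hc

lemma one_lt_sq_of_abs {c : ℝ} (hc : 1 < |c|) : 1 < c ^ 2 := (one_lt_sq_iff_one_lt_abs c).2 hc

/-! ### The three orthogonality functionals on polynomials -/

section Functionals

variable {a b c : ℝ}

/-- The functional for `|c| < 1`. The folded variable is `t = (x ^ 2 - c ^ 2) / (1 - c ^ 2)`, and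
`y = (1 - x ^ 2) / (1 - c ^ 2)` is `1 - t`. -/
lemma integral_domain_aux (ha : -1 < a) (hb : -1 < b) (hc : |c| < 1) {f H : ℝ → ℝ}
    (hf : Continuous f) :
    IntegrableOn (fun x => f x * weight a b c x) (domain c) ∧
      ((∀ x, f x * ((1 + x) * (x - c)) - f (-x) * ((1 + -x) * (-x - c)) =
          2 * x * H ((1 - x ^ 2) / (1 - c ^ 2))) →
        ∫ x in domain c, f x * weight a b c x =
          (1 - c ^ 2) ^ ((a + b) / 2) *
            ∫ t in Set.Ioo 0 1, H t * betaWeight ((a + 1) / 2) ((b + 1) / 2) t) := by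
  have hc2 := sq_lt_one_of_abs hc
  have hΔ : 0 < 1 - c ^ 2 := by linarith
  have h := integral_symmetric_weight (r₀ := |c|) (r₁ := 1) (f := f) (W := weight a b c)
    (l := fun x => (1 + x) * (x - c)) (M := 4) (H := fun t => H (1 - t))
    (g := fun t => (1 - c ^ 2) ^ ((a + 1) / 2 + (b + 1) / 2 - 2) *
      betaWeight ((b + 1) / 2) ((a + 1) / 2) t) (abs_nonneg c) hc
    ((integrableOn_betaWeight (by linarith) (by linarith)).const_mul _) hf (by fun_prop) ?_ ?_
  · refine ⟨h.1, fun hH => ?_⟩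
    rw [domain, h.2 ?_]
    · have e := integral_comp_one_sub_mul_betaWeight ((a + 1) / 2) ((b + 1) / 2) H
      simp only [mul_left_comm _ ((1 - c ^ 2) ^ (_ : ℝ))]
      rw [integral_const_mul, e, sq_abs, one_pow, ← mul_assoc, mul_comm (1 - c ^ 2),
        ← Real.rpow_add_one hΔ.ne']
      congr 2
      ring
    · intro x _
      rw [hH x, sq_abs, one_pow]
      congr 2
      field_simp
      ring
  · intro x hx hx1
    rw [abs_mul, mul_comm, show (4 : ℝ) * |x| = (2 * |x|) * 2 by ring]
    refine mul_le_mul ?_ ?_ (abs_nonneg _) (by positivity)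
    · exact (abs_sub _ _).trans (by linarith)
    · exact (abs_add_le _ _).trans (by rw [abs_one]; linarith)
  · intro x hx hx1
    have e1 : c ^ 2 < x ^ 2 := sq_lt_sq.2 hx
    have e2 := sq_lt_one_of_abs hx1
    have e3 := rpow_mul_rpow_eq_betaWeight (u := x ^ 2 - c ^ 2) (v := 1 - x ^ 2) (d := 1 - c ^ 2)
      (A := (b + 1) / 2) (B := (a + 1) / 2) (by linarith) hΔ (by linarith) (by ring)
    rw [weight, sq_abs, one_pow, add_comm ((a + 1) / 2), ← e3,
      show (b + 1) / 2 - 1 = (b - 1) / 2 by ring, show (a + 1) / 2 - 1 = (a - 1) / 2 by ring]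
    ring

/-- The functional for `|c| > 1`. Here the folded variable is `y = (1 - x ^ 2) / (1 - c ^ 2)` itself;
the sign comes from the factor `c - x` of the weight, in place of `x - c`. -/
lemma integral_domainTilde_aux (ha : -1 < a) (hb : -1 < b) (hc : 1 < |c|) {f H : ℝ → ℝ}
    (hf : Continuous f) :
    IntegrableOn (fun x => f x * weightTilde a b c x) (domainTilde c) ∧
      ((∀ x, f x * ((1 + x) * (x - c)) - f (-x) * ((1 + -x) * (-x - c)) =
          2 * x * H ((1 - x ^ 2) / (1 - c ^ 2))) →
        ∫ x in domainTilde c, f x * weightTilde a b c x =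
          -(Real.sign c * (c ^ 2 - 1) ^ ((a + b) / 2)) *
            ∫ t in Set.Ioo 0 1, H t * betaWeight ((a + 1) / 2) ((b + 1) / 2) t) := by
  have hc2 := one_lt_sq_of_abs hc
  have hΔ : 0 < c ^ 2 - 1 := by linarith
  have h := integral_symmetric_weight (r₀ := 1) (r₁ := |c|) (f := f) (W := weightTilde a b c)
    (l := fun x => (1 + x) * (x - c)) (M := 4 * |c|) (H := H)
    (g := fun t => -(Real.sign c * (c ^ 2 - 1) ^ ((a + 1) / 2 + (b + 1) / 2 - 2)) *
      betaWeight ((a + 1) / 2) ((b + 1) / 2) t) zero_le_one hc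
    ((integrableOn_betaWeight (by linarith) (by linarith)).const_mul _) hf (by fun_prop) ?_ ?_
  · refine ⟨h.1, fun hH => ?_⟩
    rw [domainTilde, h.2 ?_]
    · simp only [mul_left_comm _ (-(Real.sign c * _))]
      rw [integral_const_mul, sq_abs, one_pow, ← mul_assoc,
        show (c ^ 2 - 1) * -(Real.sign c * (c ^ 2 - 1) ^ ((a + 1) / 2 + (b + 1) / 2 - 2)) =
          -(Real.sign c * ((c ^ 2 - 1) ^ ((a + 1) / 2 + (b + 1) / 2 - 2) * (c ^ 2 - 1))) by ring,
        ← Real.rpow_add_one hΔ.ne']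
      congr 4
      ring
    · intro x _
      rw [hH x, sq_abs, one_pow, ← neg_div_neg_eq, neg_sub, neg_sub]
  · intro x hx hx1
    rw [abs_mul, show (4 * |c|) * |x| = (2 * |x|) * (2 * |c|) by ring]
    refine mul_le_mul ?_ ?_ (abs_nonneg _) (by positivity)
    · exact (abs_add_le _ _).trans (by rw [abs_one]; linarith)
    · exact (abs_sub _ _).trans (by linarith)
  · intro x hx hx1
    have e1 : x ^ 2 < c ^ 2 := sq_lt_sq.2 hx1
    have e2 := one_lt_sq_of_abs hx
    have e3 := rpow_mul_rpow_eq_betaWeight (u := x ^ 2 - 1) (v := c ^ 2 - x ^ 2) (d := c ^ 2 - 1)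
      (A := (a + 1) / 2) (B := (b + 1) / 2) (by linarith) hΔ (by linarith) (by ring)
    have e4 : Real.sign (c * x) = Real.sign c * Real.sign x := by
      have hc0 : c ≠ 0 := by rintro rfl; norm_num at hc
      have hx0 : x ≠ 0 := by rintro rfl; norm_num at hx
      rcases hc0.lt_or_gt with h | h <;> rcases hx0.lt_or_gt with h' | h'
      · rw [Real.sign_of_neg h, Real.sign_of_neg h', Real.sign_of_pos (mul_pos_of_neg_of_neg h h')]
        norm_num
      · rw [Real.sign_of_neg h, Real.sign_of_pos h', Real.sign_of_neg (mul_neg_of_neg_of_pos h h')]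
        norm_num
      · rw [Real.sign_of_pos h, Real.sign_of_neg h', Real.sign_of_neg (mul_neg_of_pos_of_neg h h')]
        norm_num
      · rw [Real.sign_of_pos h, Real.sign_of_pos h', Real.sign_of_pos (mul_pos h h')]
        norm_num
    rw [weightTilde, sq_abs, one_pow, neg_mul, mul_assoc (Real.sign c), ← e3, e4,
      show (b + 1) / 2 - 1 = (b - 1) / 2 by ring, show (a + 1) / 2 - 1 = (a - 1) / 2 by ring]
    ring

lemma integral_chiharaDomain_aux {α β : ℝ} (γ : ℝ) (hα : -1 < α) (hβ : -1 < β) {f H : ℝ → ℝ}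
    (hf : Continuous f) :
    IntegrableOn (fun x => f x * chiharaWeight α β γ x) (chiharaDomain γ) ∧
      ((∀ x, f x * (x + γ) - f (-x) * (-x + γ) = 2 * x * H (x ^ 2 - γ ^ 2)) →
        ∫ x in chiharaDomain γ, f x * chiharaWeight α β γ x =
          ∫ t in Set.Ioo 0 1, H t * betaWeight (α + 1) (β + 1) t) := by
  have hs : √(1 + γ ^ 2) ^ 2 = 1 + γ ^ 2 := Real.sq_sqrt (by positivity)
  have hlt : |γ| < √(1 + γ ^ 2) := Real.lt_sqrt_of_sq_lt (by rw [sq_abs]; linarith)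
  have hd : √(1 + γ ^ 2) ^ 2 - |γ| ^ 2 = 1 := by rw [hs, sq_abs]; ring
  have h := integral_symmetric_weight (r₀ := |γ|) (r₁ := √(1 + γ ^ 2)) (f := f)
    (W := chiharaWeight α β γ) (l := fun x => x + γ) (M := 2) (H := H)
    (g := betaWeight (α + 1) (β + 1)) (abs_nonneg γ) hlt
    (integrableOn_betaWeight (by linarith) (by linarith)) hf (by fun_prop) ?_ ?_
  · refine ⟨h.1, fun hH => ?_⟩
    rw [chiharaDomain, h.2 ?_, hd, one_mul]
    intro x _
    rw [hd, sq_abs, div_one]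
    exact hH x
  · intro x hx hx1
    exact (abs_add_le _ _).trans (by linarith)
  · intro x hx hx1
    rw [hd, sq_abs, div_one, chiharaWeight, betaWeight, add_sub_cancel_right,
      add_sub_cancel_right, show 1 - (x ^ 2 - γ ^ 2) = 1 + γ ^ 2 - x ^ 2 by ring]
    ring

end Functionals

/-! ### The Big -1 Jacobi polynomials in terms of Jacobi polynomials -/

/-- The component `P` of `J n x = P y + (1 - x) / (1 + c) * Q y`, where
`y = (1 - x ^ 2) / (1 - c ^ 2)`, `A = (a + 1) / 2` and `B = (b + 1) / 2`. -/
def bigP (A B : ℝ) (n : ℕ) : ℝ[X] := hyp (n / 2) ((n / 2 : ℕ) + A + B) A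

/-- The component `Q` of `J n x = P y + (1 - x) / (1 + c) * Q y`, where
`y = (1 - x ^ 2) / (1 - c ^ 2)`, `A = (a + 1) / 2` and `B = (b + 1) / 2`. For `n = 0` the truncated
subtraction `n / 2 - 1` is harmless, because the factor in front is zero. -/
def bigQ (A B : ℝ) (n : ℕ) : ℝ[X] :=
  if Even n then C ((n / 2 : ℕ) / A) * hyp (n / 2 - 1) ((n / 2 : ℕ) + A + B) (A + 1)
  else C (-(((n / 2 : ℕ) + A + B) / A)) * hyp (n / 2) ((n / 2 : ℕ) + A + B + 1) (A + 1)

lemma exists_eq_zero_or_odd_or_even (n : ℕ) :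
    n = 0 ∨ (∃ N, n = 2 * N + 1) ∨ ∃ N, n = 2 * (N + 1) := by
  rcases Nat.even_or_odd' n with ⟨N, rfl | rfl⟩
  · rcases N with _ | N
    · exact Or.inl rfl
    · exact Or.inr (Or.inr ⟨N, rfl⟩)
  · exact Or.inr (Or.inl ⟨N, rfl⟩)

lemma not_even_two_mul_add_one (N : ℕ) : ¬ Even (2 * N + 1) := by
  rw [Nat.not_even_iff_odd]; exact odd_two_mul_add_one N

lemma two_mul_add_one_div_two (N : ℕ) : (2 * N + 1) / 2 = N := by omega

lemma two_mul_div_two (N : ℕ) : 2 * N / 2 = N := by omega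

lemma bigP_even (A B : ℝ) (N : ℕ) : bigP A B (2 * N) = hyp N (N + A + B) A := by
  rw [bigP, two_mul_div_two]

lemma bigP_odd (A B : ℝ) (N : ℕ) : bigP A B (2 * N + 1) = hyp N (N + A + B) A := by
  rw [bigP, two_mul_add_one_div_two]

lemma bigQ_zero (A B : ℝ) : bigQ A B 0 = 0 := by simp [bigQ]

lemma bigQ_odd (A B : ℝ) (N : ℕ) :
    bigQ A B (2 * N + 1) = C (-((N + A + B) / A)) * hyp N (N + A + B + 1) (A + 1) := by
  rw [bigQ, if_neg (not_even_two_mul_add_one N), two_mul_add_one_div_two]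

lemma bigQ_even (A B : ℝ) (N : ℕ) :
    bigQ A B (2 * (N + 1)) = C ((N + 1) / A) * hyp N (N + A + B + 1) (A + 1) := by
  rw [bigQ, if_pos (even_two_mul _), two_mul_div_two, Nat.add_sub_cancel]
  push_cast
  rw [show (N : ℝ) + 1 + A + B = N + A + B + 1 by ring]

lemma J_eq (a b c : ℝ) (n : ℕ) (x : ℝ) :
    J a b c n x =
      (bigP ((a + 1) / 2) ((b + 1) / 2) n).eval ((1 - x ^ 2) / (1 - c ^ 2)) +
        (1 - x) / (1 + c) *
          (bigQ ((a + 1) / 2) ((b + 1) / 2) n).eval ((1 - x ^ 2) / (1 - c ^ 2)) := by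
  set z := (1 - x ^ 2) / (1 - c ^ 2) with hz
  rcases exists_eq_zero_or_odd_or_even n with rfl | ⟨N, rfl⟩ | ⟨N, rfl⟩
  · have := hypergeometric_neg_nat_real 0 ((a + b + 2) / 2) ((a + 1) / 2) z
    simp only [Nat.cast_zero, neg_zero, hyp_zero, eval_one] at this
    simp [J, bigQ_zero, bigP, ← hz, this]
  · rw [J, if_neg (not_even_two_mul_add_one N), bigP_odd, bigQ_odd, ← hz, eval_mul, eval_C]
    push_cast
    rw [show -((2 * (N : ℝ) + 1) - 1) / 2 = -N by ring, hypergeometric_neg_nat_real,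
      hypergeometric_neg_nat_real, show (2 * (N : ℝ) + 1 + a + b + 1) / 2 =
        N + (a + 1) / 2 + (b + 1) / 2 by ring, show (2 * (N : ℝ) + 1 + a + b + 3) / 2 =
        N + (a + 1) / 2 + (b + 1) / 2 + 1 by ring, show (a + 3) / 2 = (a + 1) / 2 + 1 by ring,
      show (N : ℝ) + (a + 1) / 2 + (b + 1) / 2 = (2 * (N : ℝ) + 1 + a + b + 1) / 2 by ring,
      div_div_div_cancel_right₀ two_ne_zero]
    simp only [div_eq_mul_inv, mul_inv]
    ring
  · rw [J, if_pos (even_two_mul _), bigP_even, bigQ_even, ← hz, eval_mul, eval_C]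
    push_cast
    rw [show -(2 * ((N : ℝ) + 1)) / 2 = -((N + 1 : ℕ) : ℝ) by push_cast; ring,
      hypergeometric_neg_nat_real, show 1 - (2 * ((N : ℝ) + 1)) / 2 = -N by ring,
      hypergeometric_neg_nat_real, show (2 * ((N : ℝ) + 1) + a + b + 2) / 2 =
        N + 1 + (a + 1) / 2 + (b + 1) / 2 by ring, show (a + 3) / 2 = (a + 1) / 2 + 1 by ring,
      show (N : ℝ) + (a + 1) / 2 + (b + 1) / 2 + 1 = N + 1 + (a + 1) / 2 + (b + 1) / 2 by ring,
      show ((N : ℝ) + 1) / ((a + 1) / 2) = 2 * (N + 1) / (a + 1) by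
        rw [div_div_eq_mul_div, mul_comm]]
    simp only [div_eq_mul_inv, mul_inv]
    ring

lemma continuous_J (a b c : ℝ) (n : ℕ) : Continuous (J a b c n) := by
  simp only [funext (J_eq a b c n)]
  have h : Continuous fun x : ℝ => (1 - x ^ 2) / (1 - c ^ 2) := by fun_prop
  exact ((Polynomial.continuous _).comp h).add
    (((continuous_const.sub continuous_id).div_const _).mul ((Polynomial.continuous _).comp h))

lemma J_one (a b c : ℝ) (n : ℕ) : J a b c n 1 = 1 := by
  rw [J_eq]; simp [bigP]

lemma bigP_add_odd {A : ℝ} (hA : 0 < A) (B : ℝ) (N : ℕ) :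
    bigP A B (2 * N + 1) + X * bigQ A B (2 * N + 1) = hyp (N + 1) (N + A + B) A := by
  rw [bigP_odd, bigQ_odd, ← hyp_contiguous_odd N _ hA, C_neg]
  ring

lemma bigP_add_even {A : ℝ} (hA : 0 < A) (B : ℝ) (N : ℕ) :
    bigP A B (2 * (N + 1)) + X * bigQ A B (2 * (N + 1)) = hyp (N + 1) (N + A + B) A := by
  rw [bigP_even, bigQ_even, ← hyp_contiguous_even N (N + A + B) hA,
    show ((N + 1 : ℕ) : ℝ) + A + B = N + A + B + 1 by push_cast; ring]
  ring

/-! ### Orthogonality of the Big -1 Jacobi polynomials -/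

/-- The value, up to a constant factor, of the orthogonality functional on the product of two
Big -1 Jacobi polynomials. -/
def bigInner (A B : ℝ) (n m : ℕ) : ℝ :=
  betaE A B ((bigP A B n + X * bigQ A B n) * (bigP A B m + X * bigQ A B m)) +
    betaE (A + 1) (B + 1) (bigQ A B n * bigQ A B m)

lemma bigInner_comm (A B : ℝ) (n m : ℕ) : bigInner A B n m = bigInner A B m n := by
  rw [bigInner, bigInner, mul_comm, mul_comm (bigQ A B n)]

/-- `bigInner` for two positive indices, with general coefficients `r` and `t` of the `bigQ` part. -/
lemma bigInner_aux {A B : ℝ} (hA : 0 < A) (hB : 0 < B) (N M : ℕ) (r t : ℝ) :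
    betaE A B (hyp (N + 1) (N + A + B) A * hyp (M + 1) (M + A + B) A) +
      betaE (A + 1) (B + 1) ((C r * hyp N (N + A + B + 1) (A + 1)) *
        (C t * hyp M (M + A + B + 1) (A + 1))) =
    if N = M then ((N + 1) * (N + A + B) / A ^ 2 + r * t) *
      betaE (A + 1) (B + 1) (hyp N (N + A + B + 1) (A + 1) * hyp N (N + A + B + 1) (A + 1))
      else 0 := by
  rw [mul_mul_mul_comm, ← C_mul, betaE_C_mul]
  split_ifs with h
  · rw [← h, betaE_hyp_sq_succ hA hB]
    ring
  · have h1 := betaE_hyp_mul_hyp_of_ne hA hB (N := N + 1) (M := M + 1) (by omega)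
    have h2 := betaE_hyp_mul_hyp_of_ne (A := A + 1) (B := B + 1) (by linarith) (by linarith) h
    rw [show ((N + 1 : ℕ) : ℝ) + A + B - 1 = N + A + B by push_cast; ring,
      show ((M + 1 : ℕ) : ℝ) + A + B - 1 = M + A + B by push_cast; ring] at h1
    rw [show (N : ℝ) + (A + 1) + (B + 1) - 1 = N + A + B + 1 by ring,
      show (M : ℝ) + (A + 1) + (B + 1) - 1 = M + A + B + 1 by ring] at h2
    rw [h1, h2]
    ring

lemma bigInner_zero {A B : ℝ} {N : ℕ} (p : ℝ[X])
    (h : bigP A B N + X * bigQ A B N = p) : bigInner A B 0 N = betaE A B p := by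
  have h0 : bigP A B 0 + X * bigQ A B 0 = 1 := by simp [bigQ_zero, bigP]
  have h1 : betaE (A + 1) (B + 1) 0 = 0 := by simp [betaE]
  rw [bigInner, h, h0, bigQ_zero, zero_mul, one_mul, h1, add_zero]

lemma betaE_hyp_succ {A B : ℝ} (hA : 0 < A) (hB : 0 < B) (N : ℕ) :
    betaE A B (hyp (N + 1) (N + A + B) A) = 0 := by
  have h1 := betaE_hyp_mul_hyp_of_ne hA hB (N := 0) (M := N + 1) (by omega)
  rw [hyp_zero, one_mul, show ((N + 1 : ℕ) : ℝ) + A + B - 1 = N + A + B by push_cast; ring] at h1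
  exact h1

/-- The two terms of `bigInner` vanish separately, except for the indices `2 * N + 1` and
`2 * (N + 1)`, which share the Jacobi degrees; for these they cancel. -/
lemma bigInner_of_ne {A B : ℝ} (hA : 0 < A) (hB : 0 < B) {n m : ℕ} (h : n ≠ m) :
    bigInner A B n m = 0 := by
  have hA' := hA.ne'
  wlog hnm : n < m generalizing n m
  · rw [bigInner_comm]
    exact this h.symm (by omega)
  rcases exists_eq_zero_or_odd_or_even n with rfl | ⟨N, rfl⟩ | ⟨N, rfl⟩ <;>
    rcases exists_eq_zero_or_odd_or_even m with rfl | ⟨M, rfl⟩ | ⟨M, rfl⟩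
  · omega
  · rw [bigInner_zero _ (bigP_add_odd hA B M), betaE_hyp_succ hA hB]
  · rw [bigInner_zero _ (bigP_add_even hA B M), betaE_hyp_succ hA hB]
  · omega
  · rw [bigInner, bigP_add_odd hA, bigP_add_odd hA, bigQ_odd, bigQ_odd, bigInner_aux hA hB,
      if_neg (by omega)]
  -- consecutive indices `2 N + 1` and `2 N + 2`: the coefficient in `bigInner_aux` is zero
  · rw [bigInner, bigP_add_odd hA, bigP_add_even hA, bigQ_odd, bigQ_even, bigInner_aux hA hB]
    split_ifs with hNM
    · subst hNM
      field_simp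
      ring
    · rfl
  · omega
  · rw [bigInner, bigP_add_odd hA, bigP_add_even hA, bigQ_odd, bigQ_even, bigInner_aux hA hB,
      if_neg (by omega)]
  · rw [bigInner, bigP_add_even hA, bigP_add_even hA, bigQ_even, bigQ_even, bigInner_aux hA hB,
      if_neg (by omega)]

lemma bigInner_self {a b : ℝ} (ha : -1 < a) (hb : -1 < b) (n : ℕ) :
    bigInner ((a + 1) / 2) ((b + 1) / 2) n n = h a b n := by
  obtain ⟨A, rfl⟩ : ∃ A, a = 2 * A - 1 := ⟨(a + 1) / 2, by ring⟩
  obtain ⟨B, rfl⟩ : ∃ B, b = 2 * B - 1 := ⟨(b + 1) / 2, by ring⟩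
  have hA : 0 < A := by linarith
  have hB : 0 < B := by linarith
  rw [show (2 * A - 1 + 1) / 2 = A by ring, show (2 * B - 1 + 1) / 2 = B by ring]
  -- the norm common to the indices `2 N + 1` and `2 N + 2`
  have hN : ∀ N : ℕ, betaE (A + 1) (B + 1)
      (hyp N (N + A + B + 1) (A + 1) * hyp N (N + A + B + 1) (A + 1)) =
      (N ! : ℕ) * poch (N + A + B + 1) N * Real.Gamma (N + 1 + A) * Real.Gamma (N + 1 + B) /
        (poch (A + 1) N ^ 2 * ((2 * N + 1 + A + B) * poch (N + A + B + 1) N *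
          Real.Gamma (N + A + B + 1))) := by
    intro N
    have h1 := betaE_hyp_sq (A := A + 1) (B := B + 1) (by linarith) (by linarith) N
    rw [show (N : ℝ) + (A + 1) + (B + 1) - 1 = N + A + B + 1 by ring] at h1
    rw [h1, show A + 1 + (B + 1) + 2 * (N : ℝ) = N + A + B + 1 + (N + 1 : ℕ) by push_cast; ring,
      Gamma_add_nat (t := N + A + B + 1) (by positivity), poch_succ, show A + 1 + (N : ℝ) = N + 1 + A by ring,
      show B + 1 + (N : ℝ) = N + 1 + B by ring]
    congr 2
    ring
  have hpos : ∀ N : ℕ, 0 < Real.Gamma (N + A + B + 1) :=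
    fun N => Real.Gamma_pos_of_pos (by positivity)
  rcases exists_eq_zero_or_odd_or_even n with rfl | ⟨N, rfl⟩ | ⟨N, rfl⟩
  · have h0 : bigP A B 0 + X * bigQ A B 0 = 1 := by simp [bigQ_zero, bigP]
    rw [bigInner_zero _ h0, betaE_one hA hB, h, if_pos (by simp)]
    simp only [Nat.cast_zero, Nat.zero_div, Nat.factorial_zero, Nat.cast_one, poch_zero]
    rw [show (0 + (2 * B - 1) + 1) / 2 = B by ring, show (0 + (2 * A - 1) + 3) / 2 = A + 1 by ring,
      Real.Gamma_add_one hA.ne', show (0 + (2 * A - 1) + (2 * B - 1) + 2) / 2 = A + B by ring]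
    have := Real.Gamma_pos_of_pos (add_pos hA hB)
    field_simp
    ring
  · rw [bigInner, bigP_add_odd hA, bigQ_odd, bigInner_aux hA hB, if_pos rfl, hN, h,
      if_neg (not_even_two_mul_add_one N), show (2 * N + 1 - 1) / 2 = N by omega,
      show (2 * N + 1 + 1) / 2 = N + 1 by omega,
      show (2 * A - 1 + 1) / 2 = A by ring, poch_succ_left A]
    push_cast
    rw [show (2 * (N : ℝ) + 1 + (2 * B - 1) + 2) / 2 = N + 1 + B by ring,
      show (2 * (N : ℝ) + 1 + (2 * A - 1) + 2) / 2 = N + 1 + A by ring,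
      show (2 * (N : ℝ) + 1 + (2 * A - 1) + (2 * B - 1) + 3) / 2 = N + A + B + 1 by ring]
    have h1 := poch_pos (t := A + 1) (by linarith) N
    have h2 := poch_pos (t := N + A + B + 1) (by positivity) N
    have h3 := hpos N
    field_simp
    ring
  · rw [bigInner, bigP_add_even hA, bigQ_even, bigInner_aux hA hB, if_pos rfl, hN, h,
      if_pos (even_two_mul _), two_mul_div_two, show (2 * A - 1 + 1) / 2 = A by ring,
      poch_succ_left A, Nat.factorial_succ]
    push_cast
    rw [show (2 * ((N : ℝ) + 1) + (2 * B - 1) + 1) / 2 = N + 1 + B by ring,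
      show (2 * ((N : ℝ) + 1) + (2 * A - 1) + 3) / 2 = N + 1 + A + 1 by ring,
      Real.Gamma_add_one (s := N + 1 + A) (by positivity),
      show (2 * ((N : ℝ) + 1) + (2 * A - 1) + 1) = 2 * (N + 1 + A) by ring,
      show (2 * ((N : ℝ) + 1) + (2 * A - 1) + (2 * B - 1) + 2) / 2 = N + A + B + 1 by ring]
    have h1 := poch_pos (t := A + 1) (by linarith) N
    have h2 := poch_pos (t := N + A + B + 1) (by positivity) N
    have h3 := hpos N
    field_simp
    ring

lemma bigInner_eq {a b : ℝ} (ha : -1 < a) (hb : -1 < b) (n m : ℕ) :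
    bigInner ((a + 1) / 2) ((b + 1) / 2) n m = h a b n * (if n = m then 1 else 0) := by
  split_ifs with hnm
  · rw [← hnm, bigInner_self ha hb, mul_one]
  · rw [bigInner_of_ne (by linarith) (by linarith) hnm, mul_zero]

/-- The part of `J n * J m` that survives the folding, as a polynomial in
`y = (1 - x ^ 2) / (1 - c ^ 2)`. -/
def bigFold (a b c : ℝ) (n m : ℕ) : ℝ[X] :=
  C (1 - c) *
    ((bigP ((a + 1) / 2) ((b + 1) / 2) n + X * bigQ ((a + 1) / 2) ((b + 1) / 2) n) *
      (bigP ((a + 1) / 2) ((b + 1) / 2) m + X * bigQ ((a + 1) / 2) ((b + 1) / 2) m) +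
      X * ((1 - X) * (bigQ ((a + 1) / 2) ((b + 1) / 2) n *
        bigQ ((a + 1) / 2) ((b + 1) / 2) m)))

lemma J_mul_J_fold (a b : ℝ) {c : ℝ} (hc1 : 1 + c ≠ 0) (hc2 : 1 - c ≠ 0) (n m : ℕ) (x : ℝ) :
    J a b c n x * J a b c m x * ((1 + x) * (x - c)) -
        J a b c n (-x) * J a b c m (-x) * ((1 + -x) * (-x - c)) =
      2 * x * (bigFold a b c n m).eval ((1 - x ^ 2) / (1 - c ^ 2)) := by
  have hc3 : 1 - c ^ 2 = (1 - c) * (1 + c) := by ring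
  simp only [bigFold, J_eq, neg_sq, eval_mul, eval_add, eval_sub, eval_C, eval_X, eval_one]
  generalize eval ((1 - x ^ 2) / (1 - c ^ 2)) (bigP ((a + 1) / 2) ((b + 1) / 2) n) = p₁
  generalize eval ((1 - x ^ 2) / (1 - c ^ 2)) (bigP ((a + 1) / 2) ((b + 1) / 2) m) = p₂
  generalize eval ((1 - x ^ 2) / (1 - c ^ 2)) (bigQ ((a + 1) / 2) ((b + 1) / 2) n) = q₁
  generalize eval ((1 - x ^ 2) / (1 - c ^ 2)) (bigQ ((a + 1) / 2) ((b + 1) / 2) m) = q₂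
  rw [hc3]
  field_simp
  ring

lemma integral_bigInner {a b : ℝ} (ha : -1 < a) (hb : -1 < b) (c : ℝ) (n m : ℕ) :
    ∫ t in Set.Ioo 0 1, (bigFold a b c n m).eval t *
        betaWeight ((a + 1) / 2) ((b + 1) / 2) t =
      (1 - c) * (h a b n * (if n = m then 1 else 0)) := by
  change betaE _ _ (bigFold a b c n m) = _
  rw [bigFold, betaE_C_mul, betaE_add (by linarith) (by linarith), betaE_X_mul, betaE_one_sub_X_mul,
    ← bigInner_eq ha hb, bigInner]

lemma integral_J_mul_J {a b c : ℝ} (ha : -1 < a) (hb : -1 < b) (hc : |c| < 1) (n m : ℕ) :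
    ∫ x in domain c, J a b c n x * J a b c m x * weight a b c x =
      (1 - c ^ 2) ^ ((a + b + 2) / 2) / (1 + c) * h a b n * (if n = m then 1 else 0) := by
  obtain ⟨h1, h2⟩ := abs_lt.1 hc
  have hc1 : 1 + c ≠ 0 := by linarith
  have hΔ : 1 - c ^ 2 ≠ 0 := by nlinarith
  rw [(integral_domain_aux (f := fun x => J a b c n x * J a b c m x)
    (H := fun t => (bigFold a b c n m).eval t) ha hb hc
    ((continuous_J a b c n).mul (continuous_J a b c m))).2
    (J_mul_J_fold a b hc1 (by linarith) n m), integral_bigInner ha hb,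
    show (a + b + 2) / 2 = (a + b) / 2 + 1 by ring, Real.rpow_add_one hΔ]
  field_simp
  ring

lemma integral_J_mul_J_tilde {a b c : ℝ} (ha : -1 < a) (hb : -1 < b) (hc : 1 < |c|) (n m : ℕ) :
    ∫ x in domainTilde c, J a b c n x * J a b c m x * weightTilde a b c x =
      Real.sign c * (c ^ 2 - 1) ^ ((a + b + 2) / 2) / (1 + c) * hTilde a b n *
        (if n = m then 1 else 0) := by
  have hΔ := one_lt_sq_of_abs hc
  have hc1 : 1 + c ≠ 0 := fun h => by nlinarith
  have hc2 : 1 - c ≠ 0 := fun h => by nlinarith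
  have hh : hTilde a b n = h a b n := rfl
  rw [(integral_domainTilde_aux (f := fun x => J a b c n x * J a b c m x)
    (H := fun t => (bigFold a b c n m).eval t) ha hb hc
    ((continuous_J a b c n).mul (continuous_J a b c m))).2
    (J_mul_J_fold a b hc1 hc2 n m), integral_bigInner ha hb, hh,
    show (a + b + 2) / 2 = (a + b) / 2 + 1 by ring, Real.rpow_add_one (by linarith)]
  field_simp
  ring

/-! ### The Christoffel transform at `1` -/

/-- The variable `y = (1 - x ^ 2) / (1 - c ^ 2)` as a polynomial in `x`. -/
def yPoly (c : ℝ) : ℝ[X] := C (1 - c ^ 2)⁻¹ * (1 - X ^ 2)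

lemma eval_yPoly (c x : ℝ) : (yPoly c).eval x = (1 - x ^ 2) / (1 - c ^ 2) := by
  simp [yPoly, div_eq_inv_mul]

lemma natDegree_one_sub_X_sq : (1 - X ^ 2 : ℝ[X]).natDegree = 2 := by
  rw [← neg_sub, natDegree_neg, ← C_1, natDegree_X_pow_sub_C]

lemma natDegree_yPoly {c : ℝ} (hc : 1 - c ^ 2 ≠ 0) : (yPoly c).natDegree = 2 := by
  rw [yPoly, natDegree_C_mul (inv_ne_zero hc), natDegree_one_sub_X_sq]

lemma leadingCoeff_yPoly (c : ℝ) : (yPoly c).leadingCoeff = (c ^ 2 - 1)⁻¹ := by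
  rw [yPoly, leadingCoeff_mul, leadingCoeff_C, ← neg_sub (X ^ 2), leadingCoeff_neg, ← C_1,
    leadingCoeff_X_pow_sub_C (by norm_num), ← neg_sub (c ^ 2), inv_neg]
  ring

/-- The Christoffel transform at `1` of the monic Big -1 Jacobi polynomials, in terms of Jacobi
polynomials in `y = (1 - x ^ 2) / (1 - c ^ 2)`. -/
def christoffel (a b c : ℝ) (n : ℕ) : ℝ[X] :=
  if Even n then C ((c ^ 2 - 1) ^ (n / 2)) *
    (jacobi (n / 2) ((a + 1) / 2 + 1) ((b + 1) / 2)).comp (yPoly c)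
  else (X + C c) * (C ((c ^ 2 - 1) ^ (n / 2)) *
    (jacobi (n / 2) ((a + 1) / 2 + 1) ((b + 1) / 2 + 1)).comp (yPoly c))

lemma christoffel_even (a b c : ℝ) (N : ℕ) : christoffel a b c (2 * N) =
    C ((c ^ 2 - 1) ^ N) * (jacobi N ((a + 1) / 2 + 1) ((b + 1) / 2)).comp (yPoly c) := by
  rw [christoffel, if_pos (even_two_mul _), two_mul_div_two]

lemma christoffel_odd (a b c : ℝ) (N : ℕ) : christoffel a b c (2 * N + 1) =
    (X + C c) * (C ((c ^ 2 - 1) ^ N) *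
      (jacobi N ((a + 1) / 2 + 1) ((b + 1) / 2 + 1)).comp (yPoly c)) := by
  rw [christoffel, if_neg (not_even_two_mul_add_one N), two_mul_add_one_div_two]

lemma monic_jacobi_comp {c : ℝ} (hc : 1 - c ^ 2 ≠ 0) (N : ℕ) {A B : ℝ} (hA : 0 < A) (hB : 0 < B) :
    (C ((c ^ 2 - 1) ^ N) * (jacobi N A B).comp (yPoly c)).Monic := by
  have hc' : c ^ 2 - 1 ≠ 0 := by rw [← neg_sub]; exact neg_ne_zero.2 hc
  rw [Monic, leadingCoeff_mul, leadingCoeff_C,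
    leadingCoeff_comp (by rw [natDegree_yPoly hc]; norm_num), monic_jacobi N hA hB,
    leadingCoeff_yPoly, natDegree_jacobi N hA hB, one_mul, ← mul_pow, mul_inv_cancel₀ hc', one_pow]

lemma natDegree_jacobi_comp {c : ℝ} (hc : 1 - c ^ 2 ≠ 0) (N : ℕ) {A B : ℝ} (hA : 0 < A)
    (hB : 0 < B) : (C ((c ^ 2 - 1) ^ N) * (jacobi N A B).comp (yPoly c)).natDegree = 2 * N := by
  have hc' : c ^ 2 - 1 ≠ 0 := by rw [← neg_sub]; exact neg_ne_zero.2 hc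
  rw [natDegree_C_mul (pow_ne_zero _ hc'), natDegree_comp, natDegree_jacobi N hA hB,
    natDegree_yPoly hc, mul_comm]

lemma monic_christoffel {a b c : ℝ} (ha : -1 < a) (hb : -1 < b) (hc : 1 - c ^ 2 ≠ 0) (n : ℕ) :
    (christoffel a b c n).Monic := by
  rcases Nat.even_or_odd' n with ⟨N, rfl | rfl⟩
  · rw [christoffel_even]
    exact monic_jacobi_comp hc N (by linarith) (by linarith)
  · rw [christoffel_odd]
    exact (monic_X_add_C c).mul (monic_jacobi_comp hc N (by linarith) (by linarith))

lemma natDegree_christoffel {a b c : ℝ} (ha : -1 < a) (hb : -1 < b) (hc : 1 - c ^ 2 ≠ 0) (n : ℕ) :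
    (christoffel a b c n).natDegree = n := by
  rcases Nat.even_or_odd' n with ⟨N, rfl | rfl⟩
  · rw [christoffel_even, natDegree_jacobi_comp hc N (by linarith) (by linarith)]
  · rw [christoffel_odd, (monic_X_add_C c).natDegree_mul
      (monic_jacobi_comp hc N (by linarith) (by linarith)), natDegree_X_add_C,
      natDegree_jacobi_comp hc N (by linarith) (by linarith), add_comm]

lemma kappa_ne_zero {a b c : ℝ} (ha : -1 < a) (hb : -1 < b) (hc : 1 - c ^ 2 ≠ 0) (n : ℕ) :
    kappa a b c n ≠ 0 := by
  have hc1 : 1 + c ≠ 0 := fun h => hc (by linear_combination (1 - c) * h)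
  have h1 := fun k => poch_ne_zero (t := (a + 1) / 2) (by linarith) k
  rw [kappa]
  split_ifs with hn
  · exact div_ne_zero (mul_ne_zero (pow_ne_zero _ hc) (h1 _))
      (poch_ne_zero (by have : (0 : ℝ) ≤ n := n.cast_nonneg
                        linarith) _)
  · have : (1 : ℝ) ≤ n := by exact_mod_cast (Nat.not_even_iff_odd.1 hn).pos
    exact div_ne_zero (mul_ne_zero (mul_ne_zero hc1 (pow_ne_zero _ hc)) (h1 _))
      (poch_ne_zero (by linarith) _)

lemma monicJ_one (a b c : ℝ) (n : ℕ) : monicJ a b c n 1 = kappa a b c n := by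
  rw [monicJ, J_one, mul_one]

lemma bigQ_sub_bigQ (A B : ℝ) (N : ℕ) :
    bigQ A B (2 * N) - bigQ A B (2 * N + 1) =
      C ((2 * N + A + B) / A) * hyp N (N + A + B) (A + 1) := by
  rcases N with _ | N
  · have h := bigQ_odd A B 0
    simp only [mul_zero, zero_add, hyp_zero, mul_one, Nat.cast_zero] at h ⊢
    rw [bigQ_zero, h, C_neg]
    ring
  · have h := hyp_contiguous_sum N (N + 1 + A + B) (A + 1)
    rw [bigQ_even, bigQ_odd]
    push_cast
    rw [show (N : ℝ) + A + B + 1 = N + 1 + A + B by ring,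
      show (2 * ((N : ℝ) + 1) + A + B) / A = (N + 1 + A + B + N + 1) * A⁻¹ by
        rw [div_eq_mul_inv]; ring, div_eq_mul_inv, div_eq_mul_inv, C_neg, C_mul, C_mul, C_mul]
    linear_combination C A⁻¹ * h

lemma bigP_sub_bigP {A : ℝ} (hA : 0 < A) (B : ℝ) (N : ℕ) :
    bigP A B (2 * (N + 1)) - bigP A B (2 * N + 1) =
      -(C ((2 * N + 1 + A + B) / A) * (X * hyp N (N + A + B + 1) (A + 1))) := by
  have h1 := bigP_add_even hA B N
  have h2 := bigP_add_odd hA B N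
  rw [bigQ_even] at h1
  rw [bigQ_odd, C_neg] at h2
  rw [show (2 * (N : ℝ) + 1 + A + B) / A = (N + 1) / A + (N + A + B) / A by ring, C_add]
  linear_combination h1 - h2

/-- The difference of two consecutive monic Big -1 Jacobi polynomials which vanishes at `1` is
`(x - 1)` times the Christoffel transform. -/
lemma sub_one_mul_christoffel {a b c : ℝ} (ha : -1 < a) (hb : -1 < b) (hc : 1 - c ^ 2 ≠ 0) (n : ℕ)
    (x : ℝ) : (x - 1) * (christoffel a b c n).eval x =
      monicJ a b c (n + 1) x - monicJ a b c (n + 1) 1 / monicJ a b c n 1 * monicJ a b c n x := by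
  have hc1 : 1 + c ≠ 0 := fun h => hc (by linear_combination (1 - c) * h)
  have hc2 : 1 - c ≠ 0 := fun h => hc (by linear_combination (1 + c) * h)
  have hc3 : 1 - c ^ 2 = (1 - c) * (1 + c) := by ring
  have hk := kappa_ne_zero ha hb hc n
  obtain ⟨A, rfl⟩ : ∃ A, a = 2 * A - 1 := ⟨(a + 1) / 2, by ring⟩
  obtain ⟨B, rfl⟩ : ∃ B, b = 2 * B - 1 := ⟨(b + 1) / 2, by ring⟩
  have hA : 0 < A := by linarith
  have hB : 0 < B := by linarith
  have eA : (2 * A - 1 + 1) / 2 = A := by ring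
  have eB : (2 * B - 1 + 1) / 2 = B := by ring
  have hsq : ∀ N : ℕ, (c ^ 2 - 1) ^ N * (-1) ^ N = (1 - c ^ 2) ^ N := by
    intro N; rw [← mul_pow]; congr 1; ring
  rw [monicJ_one, monicJ_one, monicJ, monicJ, div_mul_eq_mul_div, mul_div_assoc,
    mul_div_cancel_left₀ _ hk, ← mul_sub, J_eq, J_eq, eA, eB]
  rcases Nat.even_or_odd' n with ⟨N, rfl | rfl⟩
  · rw [christoffel_even, eA, eB, bigP_even, bigP_odd, eval_mul, eval_C, eval_comp, eval_yPoly,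
      jacobi, eval_mul, eval_C, kappa, if_neg (not_even_two_mul_add_one N),
      show (2 * N + 1 - 1) / 2 = N by omega, show (2 * N + 1 + 1) / 2 = N + 1 by omega, eA,
      poch_succ_left A, poch_succ]
    push_cast
    rw [show (N : ℝ) + (A + 1) + B - 1 = N + A + B by ring,
      show (2 * (N : ℝ) + 1 + (2 * A - 1) + (2 * B - 1) + 1) / 2 = N + A + B by ring]
    have h := congrArg (eval ((1 - x ^ 2) / (1 - c ^ 2))) (bigQ_sub_bigQ A B N)
    rw [eval_sub, eval_mul, eval_C] at h
    have hp : poch (N + A + B) N ≠ 0 := poch_ne_zero (by positivity) N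
    have hp2 : (N : ℝ) + A + B + N ≠ 0 := by positivity
    -- `bigP` is the same for `2 N` and `2 N + 1`
    have hQ : ∀ p r : ℝ, (p + r * eval ((1 - x ^ 2) / (1 - c ^ 2)) (bigQ A B (2 * N + 1))) -
        (p + r * eval ((1 - x ^ 2) / (1 - c ^ 2)) (bigQ A B (2 * N))) =
        -r * ((2 * N + A + B) / A * eval ((1 - x ^ 2) / (1 - c ^ 2)) (hyp N (N + A + B) (A + 1))) := by
      intro p r
      rw [← h]; ring
    rw [hQ, mul_left_comm _ ((c ^ 2 - 1) ^ N), mul_assoc ((-1) ^ N), ← mul_assoc (x - 1)]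
    generalize eval ((1 - x ^ 2) / (1 - c ^ 2)) (hyp N (N + A + B) (A + 1)) = F
    rw [show (c ^ 2 - 1) ^ N * ((x - 1) * ((-1) ^ N) * (poch (A + 1) N / poch (N + A + B) N * F)) =
      ((c ^ 2 - 1) ^ N * (-1) ^ N) * ((x - 1) * (poch (A + 1) N / poch (N + A + B) N * F)) by ring,
      hsq]
    field_simp
    ring
  · rw [christoffel_odd, eA, eB, show 2 * N + 1 + 1 = 2 * (N + 1) by ring, eval_mul, eval_add,
      eval_X, eval_C, eval_mul, eval_C, eval_comp, eval_yPoly, jacobi, eval_mul, eval_C, kappa,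
      if_pos (even_two_mul _), two_mul_div_two, eA, poch_succ_left A, poch_succ,
      pow_succ (1 - c ^ 2) N]
    push_cast
    rw [show (N : ℝ) + (A + 1) + (B + 1) - 1 = N + A + B + 1 by ring,
      show (2 * ((N : ℝ) + 1) + (2 * A - 1) + (2 * B - 1) + 2) / 2 = N + A + B + 1 by ring]
    have h := congrArg (eval ((1 - x ^ 2) / (1 - c ^ 2))) (bigP_sub_bigP hA B N)
    rw [eval_sub, eval_neg, eval_mul, eval_C, eval_mul, eval_X] at h
    have hp : poch (N + A + B + 1) N ≠ 0 := poch_ne_zero (by positivity) N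
    have hp2 : (N : ℝ) + A + B + 1 + N ≠ 0 := by positivity
    -- both components of the difference are multiples of the same Jacobi polynomial
    have hP : ∀ q q' : ℝ, (eval ((1 - x ^ 2) / (1 - c ^ 2)) (bigP A B (2 * (N + 1))) + q) -
        (eval ((1 - x ^ 2) / (1 - c ^ 2)) (bigP A B (2 * N + 1)) + q') =
        -((2 * N + 1 + A + B) / A * ((1 - x ^ 2) / (1 - c ^ 2) *
          eval ((1 - x ^ 2) / (1 - c ^ 2)) (hyp N (N + A + B + 1) (A + 1)))) + (q - q') := by
      intro q q'
      rw [← h]; ring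
    rw [hP, bigQ_even, bigQ_odd, eval_mul, eval_mul, eval_C, eval_C]
    generalize eval ((1 - x ^ 2) / (1 - c ^ 2)) (hyp N (N + A + B + 1) (A + 1)) = F
    rw [show (x - 1) * ((x + c) * ((c ^ 2 - 1) ^ N * ((-1) ^ N * (poch (A + 1) N /
        poch (N + A + B + 1) N) * F))) = ((c ^ 2 - 1) ^ N * (-1) ^ N) *
        ((x - 1) * (x + c) * (poch (A + 1) N / poch (N + A + B + 1) N * F)) by ring, hsq]
    generalize (1 - c ^ 2) ^ N = D
    rw [hc3]
    field_simp
    ring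

lemma kernel_eq {a b c : ℝ} (ha : -1 < a) (hb : -1 < b) (hc : 1 - c ^ 2 ≠ 0) (n : ℕ) {x : ℝ}
    (hx : x ≠ 1) : (christoffel a b c n).eval x = kernel a b c 1 n x := by
  rw [kernel, ← sub_one_mul_christoffel ha hb hc, mul_div_cancel_left₀ _ (sub_ne_zero.2 hx)]

/-- The junk value of `kernel` at `1` is harmless because of the factor `x - 1`. -/
lemma sub_one_mul_kernel {a b c : ℝ} (ha : -1 < a) (hb : -1 < b) (hc : 1 - c ^ 2 ≠ 0) (n : ℕ)
    (x : ℝ) : (x - 1) * kernel a b c 1 n x = (x - 1) * (christoffel a b c n).eval x := by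
  by_cases hx : x = 1
  · simp [hx]
  · rw [kernel_eq ha hb hc n hx]

/-- Monicity of the Big -1 Jacobi polynomials follows by induction from that of the Christoffel
transforms. -/
lemma exists_monic_eval_eq_monicJ {a b c : ℝ} (ha : -1 < a) (hb : -1 < b) (hc : 1 - c ^ 2 ≠ 0)
    (n : ℕ) : ∃ P : ℝ[X], P.Monic ∧ P.natDegree = n ∧ ∀ x, P.eval x = monicJ a b c n x := by
  induction n with
  | zero =>
    refine ⟨1, monic_one, natDegree_one, fun x => ?_⟩
    rw [monicJ, J_eq, bigQ_zero, bigP, kappa]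
    simp
  | succ n ih =>
    obtain ⟨P, hP, hdeg, heval⟩ := ih
    have hK := monic_christoffel ha hb hc n
    have hKd := natDegree_christoffel ha hb hc n
    have h1 : ((X - C 1) * christoffel a b c n).Monic := (monic_X_sub_C 1).mul hK
    have h2 : ((X - C 1) * christoffel a b c n).natDegree = n + 1 := by
      rw [(monic_X_sub_C 1).natDegree_mul hK, natDegree_X_sub_C, hKd, add_comm]
    have h3 : (C (monicJ a b c (n + 1) 1 / monicJ a b c n 1) * P).natDegree <
        ((X - C 1) * christoffel a b c n).natDegree := by
      rw [h2]
      exact (natDegree_C_mul_le _ _).trans_lt (by omega)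
    refine ⟨(X - C 1) * christoffel a b c n +
      C (monicJ a b c (n + 1) 1 / monicJ a b c n 1) * P,
      h1.add_of_left (degree_lt_degree h3), ?_, fun x => ?_⟩
    · rw [natDegree_add_eq_left_of_natDegree_lt h3, h2]
    · have h := sub_one_mul_christoffel ha hb hc n x
      simp only [eval_add, eval_mul, eval_sub, eval_X, eval_C, heval]
      linear_combination h

/-! ### The Chihara polynomials -/

lemma chihara_even {𝕜 : Type*} [RCLike 𝕜] (α β z : ℝ) {γ x : 𝕜} (hz : x ^ 2 - γ ^ 2 = (z : 𝕜))
    (N : ℕ) : chihara (α : 𝕜) (β : 𝕜) γ (2 * N) x =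
      (((jacobi N (α + 1) (β + 1)).eval z : ℝ) : 𝕜) := by
  have h1 := poch_ofReal (𝕂 := 𝕜) (α + 1) N
  have h2 := poch_ofReal (𝕂 := 𝕜) (N + (α + 1) + (β + 1) - 1) N
  have h3 := hypergeometric_neg_nat (𝕜 := 𝕜) N (N + (α + 1) + (β + 1) - 1) (α + 1) z
  rw [show (N : ℝ) + (α + 1) + (β + 1) - 1 = N + α + β + 1 by ring] at h2 h3
  simp only [RCLike.ofReal_add, RCLike.ofReal_one, RCLike.ofReal_natCast] at h1 h2 h3
  simp only [chihara, if_pos (even_two_mul N), two_mul_div_two]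
  rw [hz, h3, jacobi, show (N : ℝ) + (α + 1) + (β + 1) - 1 = N + α + β + 1 by ring, h1, h2,
    eval_mul, eval_C]
  simp

lemma chihara_odd {𝕜 : Type*} [RCLike 𝕜] (α β z : ℝ) {γ x : 𝕜} (hz : x ^ 2 - γ ^ 2 = (z : 𝕜))
    (N : ℕ) : chihara (α : 𝕜) (β : 𝕜) γ (2 * N + 1) x =
      (x - γ) * (((jacobi N (α + 2) (β + 1)).eval z : ℝ) : 𝕜) := by
  have h1 := poch_ofReal (𝕂 := 𝕜) (α + 2) N
  have h2 := poch_ofReal (𝕂 := 𝕜) (N + (α + 2) + (β + 1) - 1) N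
  have h3 := hypergeometric_neg_nat (𝕜 := 𝕜) N (N + (α + 2) + (β + 1) - 1) (α + 2) z
  rw [show (N : ℝ) + (α + 2) + (β + 1) - 1 = N + α + β + 2 by ring] at h2 h3
  simp only [RCLike.ofReal_add, RCLike.ofReal_ofNat, RCLike.ofReal_natCast] at h1 h2 h3
  simp only [chihara, if_neg (not_even_two_mul_add_one N), two_mul_add_one_div_two]
  rw [hz, h3, jacobi, show (N : ℝ) + (α + 2) + (β + 1) - 1 = N + α + β + 2 by ring, h1, h2,
    eval_mul, eval_C]
  simp only [RCLike.ofReal_mul, RCLike.ofReal_div, RCLike.ofReal_pow, RCLike.ofReal_neg,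
    RCLike.ofReal_one]
  ring

/-- The reflection formula in the form relating the folded variables of the two families. -/
lemma eval_jacobi_one_sub (N : ℕ) {A B : ℝ} (hA : 0 < A) (hB : 0 < B) (y : ℝ) :
    (jacobi N B A).eval (1 - y) = (-1) ^ N * (jacobi N A B).eval y := by
  have h := congrArg (eval y) (jacobi_comp_one_sub N hA hB)
  simpa [eval_comp] using h

/-- The Christoffel transform is a rescaled Chihara polynomial, for either square root `s` of
`1 - c ^ 2`. -/
lemma christoffel_eq_chihara {𝕜 : Type*} [RCLike 𝕜] {a b c : ℝ} (ha : -1 < a) (hb : -1 < b)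
    (hc : 1 - c ^ 2 ≠ 0) (n : ℕ) (s : 𝕜) (hs : s ^ 2 = 1 - (c : 𝕜) ^ 2) (x : ℝ) :
    (((christoffel a b c n).eval x : ℝ) : 𝕜) =
      s ^ n * chihara (((b : 𝕜) - 1) / 2) (((a : 𝕜) + 1) / 2) (-(c : 𝕜) / s) n ((x : 𝕜) / s) := by
  have hs2 : s ^ 2 = ((1 - c ^ 2 : ℝ) : 𝕜) := by rw [hs]; push_cast; rfl
  have hs0 : s ≠ 0 := by
    rintro rfl
    rw [zero_pow two_ne_zero] at hs2
    exact hc (by exact_mod_cast hs2.symm)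
  have hα : ((b : 𝕜) - 1) / 2 = (((b - 1) / 2 : ℝ) : 𝕜) := by push_cast; rfl
  have hβ : ((a : 𝕜) + 1) / 2 = (((a + 1) / 2 : ℝ) : 𝕜) := by push_cast; rfl
  have hz : ((x : 𝕜) / s) ^ 2 - (-(c : 𝕜) / s) ^ 2 =
      ((1 - (1 - x ^ 2) / (1 - c ^ 2) : ℝ) : 𝕜) := by
    rw [div_pow, div_pow, hs2, show 1 - (1 - x ^ 2) / (1 - c ^ 2) = (x ^ 2 - c ^ 2) / (1 - c ^ 2) by
      field_simp; ring]
    push_cast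
    ring
  have hpow : ∀ (N : ℕ) (r : ℝ), s ^ (2 * N) * (((-1) ^ N * r : ℝ) : 𝕜) =
      (((c ^ 2 - 1) ^ N * r : ℝ) : 𝕜) := by
    intro N r
    rw [pow_mul, hs2, show c ^ 2 - 1 = (1 - c ^ 2) * (-1) by ring, mul_pow]
    push_cast
    ring
  rw [hα, hβ]
  rcases Nat.even_or_odd' n with ⟨N, rfl | rfl⟩
  · rw [chihara_even _ _ _ hz, show (b - 1) / 2 + 1 = (b + 1) / 2 by ring,
      eval_jacobi_one_sub N (by linarith) (by linarith), hpow, christoffel_even, eval_mul, eval_C,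
      eval_comp, eval_yPoly]
  · rw [chihara_odd _ _ _ hz, show (b - 1) / 2 + 2 = (b + 1) / 2 + 1 by ring,
      eval_jacobi_one_sub N (by linarith) (by linarith), pow_succ, mul_assoc,
      show ∀ u : 𝕜, s * (((x : 𝕜) / s - -(c : 𝕜) / s) * u) = (x + c) * u by
        intro u; field_simp; ring, mul_left_comm, hpow, christoffel_odd, eval_mul, eval_mul,
      eval_C, eval_comp, eval_yPoly, eval_add, eval_X, eval_C, RCLike.ofReal_mul,
      RCLike.ofReal_add]

lemma integral_chihara_mul_chihara_aux {α β : ℝ} (γ : ℝ) (hα : -1 < α) (hβ : -1 < β)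
    {f : ℝ → ℝ} {p : ℝ[X]} (hf : Continuous f)
    (hp : ∀ x, f x * (x + γ) - f (-x) * (-x + γ) = 2 * x * p.eval (x ^ 2 - γ ^ 2)) :
    ∫ x in chiharaDomain γ, f x * chiharaWeight α β γ x = betaE (α + 1) (β + 1) p :=
  (integral_chiharaDomain_aux (H := fun t => p.eval t) γ hα hβ hf).2 hp

lemma chihara_even_real (α β γ x : ℝ) (N : ℕ) : chihara α β γ (2 * N) x =
    (jacobi N (α + 1) (β + 1)).eval (x ^ 2 - γ ^ 2) := by
  simpa using chihara_even (𝕜 := ℝ) α β (x ^ 2 - γ ^ 2) (γ := γ) (x := x) rfl N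

lemma chihara_odd_real (α β γ x : ℝ) (N : ℕ) : chihara α β γ (2 * N + 1) x =
    (x - γ) * (jacobi N (α + 2) (β + 1)).eval (x ^ 2 - γ ^ 2) := by
  simpa using chihara_odd (𝕜 := ℝ) α β (x ^ 2 - γ ^ 2) (γ := γ) (x := x) rfl N

lemma continuous_chihara (α β γ : ℝ) (n : ℕ) : Continuous fun x => chihara α β γ n x := by
  have h : Continuous fun x : ℝ => x ^ 2 - γ ^ 2 := by fun_prop
  rcases Nat.even_or_odd' n with ⟨N, rfl | rfl⟩
  · simp only [chihara_even_real]
    exact (Polynomial.continuous _).comp h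
  · simp only [chihara_odd_real]
    exact (continuous_id.sub continuous_const).mul ((Polynomial.continuous _).comp h)

lemma chiharaEta_even {α β : ℝ} (hα : -1 < α) (hβ : -1 < β) (N : ℕ) :
    betaE (α + 1) (β + 1) (jacobi N (α + 1) (β + 1) * jacobi N (α + 1) (β + 1)) =
      chiharaEta α β (2 * N) := by
  rw [betaE_jacobi_sq (by linarith) (by linarith)]
  rcases N with _ | N
  · simp only [chiharaEta, mul_zero, if_true, Nat.factorial_zero, Nat.cast_zero, poch_zero,
      Nat.cast_one, add_zero, one_mul]
    rw [show α + 1 + (β + 1) = α + β + 2 by ring]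
  · have hpos : 0 < ((N + 1 : ℕ) : ℝ) + α + β + 1 := by
      push_cast
      have : (0 : ℝ) ≤ N := N.cast_nonneg
      linarith
    simp only [chiharaEta, if_neg (show ¬ 2 * (N + 1) = 0 by omega), if_pos (even_two_mul _),
      two_mul_div_two]
    rw [show ((N + 1 : ℕ) : ℝ) + (α + 1) + (β + 1) - 1 = (N + 1 : ℕ) + α + β + 1 by ring,
      show α + 1 + (β + 1) + 2 * ((N + 1 : ℕ) : ℝ) =
        ((N + 1 : ℕ) + α + β + 1) + ((N + 1 + 1 : ℕ)) by push_cast; ring,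
      Gamma_add_nat hpos, poch_succ _ (N + 1), show α + 1 + ((N + 1 : ℕ) : ℝ) = (N + 1 : ℕ) + α + 1
        by ring, show β + 1 + ((N + 1 : ℕ) : ℝ) = (N + 1 : ℕ) + β + 1 by ring,
      show 2 * ((N + 1 : ℕ) : ℝ) + α + β + 1 = (N + 1 : ℕ) + α + β + 1 + (N + 1 : ℕ) by ring]
    have h1 := poch_pos hpos (N + 1)
    have h2 := Real.Gamma_pos_of_pos hpos
    have h3 : 0 < ((N + 1 : ℕ) : ℝ) + α + β + 1 + (N + 1 : ℕ) := by positivity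
    field_simp

lemma chiharaEta_odd {α β : ℝ} (hα : -1 < α) (hβ : -1 < β) (N : ℕ) :
    betaE (α + 2) (β + 1) (jacobi N (α + 2) (β + 1) * jacobi N (α + 2) (β + 1)) =
      chiharaEta α β (2 * N + 1) := by
  have hN : (0 : ℝ) ≤ N := N.cast_nonneg
  have hpos : 0 < (N : ℝ) + α + β + 2 := by linarith
  rw [betaE_jacobi_sq (by linarith) (by linarith)]
  simp only [chiharaEta, if_neg (show ¬ 2 * N + 1 = 0 by omega),
    if_neg (not_even_two_mul_add_one N), two_mul_add_one_div_two]
  rw [show (N : ℝ) + (α + 2) + (β + 1) - 1 = N + α + β + 2 by ring,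
    show α + 2 + (β + 1) + 2 * (N : ℝ) = (N + α + β + 2) + (N + 1 : ℕ) by push_cast; ring,
    Gamma_add_nat hpos, poch_succ, show α + 2 + (N : ℝ) = N + α + 2 by ring,
    show β + 1 + (N : ℝ) = N + β + 1 by ring,
    show 2 * (N : ℝ) + α + β + 2 = N + α + β + 2 + N by ring]
  have h1 := poch_pos hpos N
  have h2 := Real.Gamma_pos_of_pos hpos
  have h3 : 0 < (N : ℝ) + α + β + 2 + N := by positivity
  field_simp

/-- For opposite parities the odd part of the integrand vanishes; for two odd degrees the factor
`(x - γ) ^ 2` folds to the variable `x ^ 2 - γ ^ 2`, which raises the first beta parameter. -/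
lemma integral_chihara_mul_chihara {α β : ℝ} (γ : ℝ) (hα : -1 < α) (hβ : -1 < β) (n m : ℕ) :
    ∫ x in chiharaDomain γ, chihara α β γ n x * chihara α β γ m x * chiharaWeight α β γ x =
      chiharaEta α β n * (if n = m then 1 else 0) := by
  have hcont : ∀ n m, Continuous fun x => chihara α β γ n x * chihara α β γ m x :=
    fun n m => (continuous_chihara α β γ n).mul (continuous_chihara α β γ m)
  have hcross : ∀ N M : ℕ, ∫ x in chiharaDomain γ,
      chihara α β γ (2 * N) x * chihara α β γ (2 * M + 1) x * chiharaWeight α β γ x = 0 := by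
    intro N M
    rw [integral_chihara_mul_chihara_aux (p := 0) γ hα hβ (hcont _ _)]
    · simp [betaE]
    · intro x
      simp only [chihara_even_real, chihara_odd_real, neg_sq, eval_zero]
      ring
  rcases Nat.even_or_odd' n with ⟨N, rfl | rfl⟩ <;> rcases Nat.even_or_odd' m with ⟨M, rfl | rfl⟩
  · rw [integral_chihara_mul_chihara_aux
      (p := jacobi N (α + 1) (β + 1) * jacobi M (α + 1) (β + 1)) γ hα hβ (hcont _ _)]
    · split_ifs with h
      · obtain rfl : N = M := by omega
        rw [chiharaEta_even hα hβ, mul_one]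
      · rw [betaE_jacobi_mul_jacobi_of_ne (by linarith) (by linarith) (by omega), mul_zero]
    · intro x
      simp only [chihara_even_real, neg_sq, eval_mul]
      ring
  · rw [hcross, if_neg (by omega), mul_zero]
  · rw [if_neg (by omega), mul_zero, ← hcross M N]
    simp only [mul_comm (chihara α β γ (2 * N + 1) _)]
  · rw [integral_chihara_mul_chihara_aux
      (p := X * (jacobi N (α + 2) (β + 1) * jacobi M (α + 2) (β + 1))) γ hα hβ (hcont _ _),
      betaE_X_mul, show α + 1 + 1 = α + 2 by ring]
    · split_ifs with h
      · obtain rfl : N = M := by omega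
        rw [chiharaEta_odd hα hβ, mul_one]
      · rw [betaE_jacobi_mul_jacobi_of_ne (by linarith) (by linarith) (by omega), mul_zero]
    · intro x
      simp only [chihara_odd_real, neg_sq, eval_mul, eval_X]
      ring

/-! ### The orthogonality functional as a linear form on polynomials -/

lemma integrableOn_weight {a b c : ℝ} (ha : -1 < a) (hb : -1 < b) (hc : |c| < 1) (p : ℝ[X]) :
    IntegrableOn (fun x => p.eval x * weight a b c x) (domain c) :=
  (integral_domain_aux (H := 0) ha hb hc p.continuous).1

lemma integrableOn_weightTilde {a b c : ℝ} (ha : -1 < a) (hb : -1 < b) (hc : 1 < |c|) (p : ℝ[X]) :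
    IntegrableOn (fun x => p.eval x * weightTilde a b c x) (domainTilde c) :=
  (integral_domainTilde_aux (H := 0) ha hb hc p.continuous).1

lemma integrableOn_chiharaWeight {α β : ℝ} (hα : -1 < α) (hβ : -1 < β) (γ : ℝ) (p : ℝ[X]) :
    IntegrableOn (fun x => p.eval x * chiharaWeight α β γ x) (chiharaDomain γ) :=
  (integral_chiharaDomain_aux (H := 0) γ hα hβ p.continuous).1

lemma one_sub_sq_ne_zero {c : ℝ} (hc : |c| ≠ 1) : 1 - c ^ 2 ≠ 0 := by
  intro h
  refine hc ((pow_left_inj₀ (abs_nonneg c) zero_le_one two_ne_zero).1 ?_)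
  rw [sq_abs]
  linarith

/-- The orthogonality functional of the Big -1 Jacobi polynomials as a linear form on `ℝ[X]`. -/
def functionalPoly {a b c : ℝ} (ha : -1 < a) (hb : -1 < b) (hc : |c| ≠ 1) : ℝ[X] →ₗ[ℝ] ℝ where
  toFun p := functional a b c fun x => p.eval x
  map_add' p q := by
    simp only [functional, eval_add, add_mul]
    split_ifs with h
    · exact integral_add (integrableOn_weight ha hb h p) (integrableOn_weight ha hb h q)
    · have h' := lt_of_le_of_ne (not_lt.1 h) hc.symm
      exact integral_add (integrableOn_weightTilde ha hb h' p) (integrableOn_weightTilde ha hb h' q)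
  map_smul' r p := by
    simp only [functional, eval_smul, smul_eq_mul, mul_assoc, integral_const_mul, RingHom.id_apply,
      mul_ite]

lemma functional_monicJ_mul_of_ne {a b c : ℝ} (ha : -1 < a) (hb : -1 < b) (hc : |c| ≠ 1) {n m : ℕ}
    (hnm : n ≠ m) : functional a b c (fun x => monicJ a b c n x * monicJ a b c m x) = 0 := by
  have e : ∀ w : ℝ → ℝ, (fun x => monicJ a b c n x * monicJ a b c m x * w x) =
      fun x => kappa a b c n * kappa a b c m * (J a b c n x * J a b c m x * w x) := by
    intro w
    funext x
    simp only [monicJ]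
    ring
  rw [functional]
  split_ifs with h
  · rw [e, integral_const_mul, integral_J_mul_J ha hb h, if_neg hnm]
    ring
  · rw [e, integral_const_mul,
      integral_J_mul_J_tilde ha hb (lt_of_le_of_ne (not_lt.1 h) hc.symm), if_neg hnm]
    ring

/-- A polynomial of degree less than `n` is orthogonal to the `n`-th member of a monic orthogonal
sequence. -/
lemma apply_mul_eq_zero_of_natDegree_lt {L : ℝ[X] →ₗ[ℝ] ℝ} {P : ℕ → ℝ[X]}
    (hm : ∀ n, (P n).Monic) (hd : ∀ n, (P n).natDegree = n)
    (ho : ∀ n m, n ≠ m → L (P n * P m) = 0) (n : ℕ) (q : ℝ[X]) (hq : q.degree < n) :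
    L (P n * q) = 0 := by
  suffices h : ∀ k ≤ n, ∀ q : ℝ[X], q.degree < k → L (P n * q) = 0 from h n le_rfl q hq
  intro k
  induction k with
  | zero =>
    intro _ q hq
    have : q = 0 := by
      rw [← degree_eq_bot, ← Nat.WithBot.lt_zero_iff]
      exact_mod_cast hq
    simp [this]
  | succ k ih =>
    intro hk q hq
    have h1 : (q - C (q.coeff k) * P k).degree < k := by
      refine (degree_lt_iff_coeff_zero _ _).2 fun m hm' => ?_
      rw [coeff_sub, coeff_C_mul]
      rcases hm'.eq_or_lt with rfl | hlt
      · have : (P k).coeff k = 1 := by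
          have := hm k
          rwa [Monic, leadingCoeff, hd k] at this
        rw [this, mul_one, sub_self]
      · rw [(degree_lt_iff_coeff_zero _ _).1 hq m hlt,
          coeff_eq_zero_of_natDegree_lt (p := P k) (by rw [hd k]; exact hlt), mul_zero, sub_zero]
    have h2 := ih (by omega) _ h1
    rw [show P n * (q - C (q.coeff k) * P k) = P n * q - q.coeff k • (P n * P k) by
      rw [smul_eq_C_mul]; ring, map_sub, map_smul, ho n k (by omega), smul_zero, sub_zero] at h2
    exact h2

lemma apply_mul_eq_of_monic {L : ℝ[X] →ₗ[ℝ] ℝ} {P : ℕ → ℝ[X]}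
    (hm : ∀ n, (P n).Monic) (hd : ∀ n, (P n).natDegree = n)
    (ho : ∀ n m, n ≠ m → L (P n * P m) = 0) {n : ℕ} {q : ℝ[X]} (hq : q.Monic)
    (hqd : q.natDegree = n) : L (P n * q) = L (P n * P n) := by
  have h : L (P n * (q - P n)) = 0 := by
    refine apply_mul_eq_zero_of_natDegree_lt hm hd ho n _ ?_
    have h1 : q.degree = (P n).degree := by
      rw [degree_eq_natDegree hq.ne_zero, degree_eq_natDegree (hm n).ne_zero, hqd, hd]
    have h2 := degree_sub_lt_left h1 hq.ne_zero (by rw [hq.leadingCoeff, (hm n).leadingCoeff])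
    rwa [degree_eq_natDegree hq.ne_zero, hqd] at h2
  rw [mul_sub, map_sub] at h
  linarith

lemma functional_christoffel_mul {a b c : ℝ} (ha : -1 < a) (hb : -1 < b) (hc : |c| ≠ 1) (n : ℕ)
    {q : ℝ[X]} (hq : q.Monic) (hqd : q.natDegree ≤ n) :
    functional a b c (fun x => (x - 1) * (christoffel a b c n).eval x * q.eval x) =
      -(monicJ a b c (n + 1) 1 / monicJ a b c n 1) *
        functional a b c (fun x => monicJ a b c n x ^ 2) * (if q.natDegree = n then 1 else 0) := by
  have hΔ : 1 - c ^ 2 ≠ 0 := one_sub_sq_ne_zero hc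
  choose P hm hd he using exists_monic_eval_eq_monicJ (c := c) ha hb hΔ
  set L := functionalPoly ha hb hc
  have hL : ∀ p : ℝ[X], L p = functional a b c fun x => p.eval x := fun p => rfl
  have ho : ∀ n m, n ≠ m → L (P n * P m) = 0 := by
    intro n m hnm
    rw [hL]
    simp only [eval_mul, he]
    exact functional_monicJ_mul_of_ne ha hb hc hnm
  set ρ := monicJ a b c (n + 1) 1 / monicJ a b c n 1
  have h1 : functional a b c (fun x => (x - 1) * (christoffel a b c n).eval x * q.eval x) =
      L (P (n + 1) * q - ρ • (P n * q)) := by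
    rw [hL]
    congr 1
    funext x
    rw [sub_one_mul_christoffel ha hb hΔ]
    simp only [eval_sub, eval_mul, eval_smul, smul_eq_mul, he]
    ring
  have h2 : functional a b c (fun x => monicJ a b c n x ^ 2) = L (P n * P n) := by
    rw [hL]
    simp only [eval_mul, he, sq]
  have hdeg : q.degree < (n + 1 : ℕ) :=
    degree_le_natDegree.trans_lt (by exact_mod_cast Nat.lt_succ_of_le hqd)
  rw [h1, h2, map_sub, map_smul, apply_mul_eq_zero_of_natDegree_lt hm hd ho _ _ hdeg, smul_eq_mul]
  split_ifs with h
  · rw [apply_mul_eq_of_monic hm hd ho hq h]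
    ring
  · rw [apply_mul_eq_zero_of_natDegree_lt hm hd ho n q
      (degree_le_natDegree.trans_lt (by exact_mod_cast lt_of_le_of_ne hqd h))]
    ring

end BigJacobi

end

theorem mainTheorem7 :
    (∀ a b c : ℝ, -1 < a → -1 < b →
      -- orthogonality and normalization for |c| < 1
      (|c| < 1 →
        (∀ p : ℝ[X], IntegrableOn (fun x => p.eval x * BigJacobi.weight a b c x)
          (BigJacobi.domain c)) ∧
        ∀ n m : ℕ,
          ∫ x in BigJacobi.domain c,
              BigJacobi.J a b c n x * BigJacobi.J a b c m x * BigJacobi.weight a b c x =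
            (1 - c ^ 2) ^ ((a + b + 2) / 2) / (1 + c) * BigJacobi.h a b n *
              (if n = m then 1 else 0)) ∧
      -- orthogonality and normalization for |c| > 1
      (1 < |c| →
        (∀ p : ℝ[X], IntegrableOn (fun x => p.eval x * BigJacobi.weightTilde a b c x)
          (BigJacobi.domainTilde c)) ∧
        ∀ n m : ℕ,
          ∫ x in BigJacobi.domainTilde c,
              BigJacobi.J a b c n x * BigJacobi.J a b c m x * BigJacobi.weightTilde a b c x =
            Real.sign c * (c ^ 2 - 1) ^ ((a + b + 2) / 2) / (1 + c) * BigJacobi.hTilde a b n *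
              (if n = m then 1 else 0)) ∧
      -- the monic polynomials, their Christoffel transform at 1 and the Chihara polynomials
      (|c| ≠ 1 → ∀ n : ℕ,
        (∃ P : ℝ[X], P.Monic ∧ P.natDegree = n ∧ ∀ x, P.eval x = BigJacobi.monicJ a b c n x) ∧
        BigJacobi.monicJ a b c n 1 ≠ 0 ∧
        (∃ K : ℝ[X], K.Monic ∧ K.natDegree = n ∧
          (∀ x, x ≠ 1 → K.eval x = BigJacobi.kernel a b c 1 n x) ∧
          (|c| < 1 → ∀ x : ℝ, K.eval x =
            √(1 - c ^ 2) ^ n *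
              BigJacobi.chihara ((b - 1) / 2) ((a + 1) / 2) (-c / √(1 - c ^ 2)) n
                (x / √(1 - c ^ 2))) ∧
          (∀ s : ℂ, s ^ 2 = 1 - (c : ℂ) ^ 2 → ∀ x : ℝ, ((K.eval x : ℝ) : ℂ) =
            s ^ n *
              BigJacobi.chihara (((b : ℂ) - 1) / 2) (((a : ℂ) + 1) / 2) (-(c : ℂ) / s) n
                ((x : ℂ) / s))) ∧
        (∀ k : ℕ, k ≤ n →
          BigJacobi.functional a b c (fun x => (x - 1) * BigJacobi.kernel a b c 1 n x * x ^ k) =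
            -(BigJacobi.monicJ a b c (n + 1) 1 / BigJacobi.monicJ a b c n 1) *
              BigJacobi.functional a b c (fun x => BigJacobi.monicJ a b c n x ^ 2) *
              (if k = n then 1 else 0)) ∧
        BigJacobi.functional a b c (fun x => (x - 1) * BigJacobi.kernel a b c 1 n x ^ 2) =
          -(BigJacobi.monicJ a b c (n + 1) 1 / BigJacobi.monicJ a b c n 1) *
            BigJacobi.functional a b c (fun x => BigJacobi.monicJ a b c n x ^ 2))) ∧
    -- orthogonality and normalization of the Chihara polynomials
    (∀ α β γ : ℝ, -1 < α → -1 < β →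
      (∀ p : ℝ[X], IntegrableOn (fun x => p.eval x * BigJacobi.chiharaWeight α β γ x)
        (BigJacobi.chiharaDomain γ)) ∧
      ∀ n m : ℕ,
        ∫ x in BigJacobi.chiharaDomain γ,
            BigJacobi.chihara α β γ n x * BigJacobi.chihara α β γ m x *
              BigJacobi.chiharaWeight α β γ x =
          BigJacobi.chiharaEta α β n * (if n = m then 1 else 0)) := by
  refine ⟨fun a b c ha hb => ⟨fun hc => ⟨BigJacobi.integrableOn_weight ha hb hc,
    BigJacobi.integral_J_mul_J ha hb hc⟩, fun hc => ⟨BigJacobi.integrableOn_weightTilde ha hb hc,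
    BigJacobi.integral_J_mul_J_tilde ha hb hc⟩, fun hc n => ?_⟩,
    fun α β γ hα hβ => ⟨BigJacobi.integrableOn_chiharaWeight hα hβ γ,
      BigJacobi.integral_chihara_mul_chihara γ hα hβ⟩⟩
  have hΔ : 1 - c ^ 2 ≠ 0 := BigJacobi.one_sub_sq_ne_zero hc
  have hmonic := BigJacobi.monic_christoffel ha hb hΔ n
  have hdeg := BigJacobi.natDegree_christoffel ha hb hΔ n
  refine ⟨BigJacobi.exists_monic_eval_eq_monicJ ha hb hΔ n, ?_,
    ⟨BigJacobi.christoffel a b c n, hmonic, hdeg, fun x hx => BigJacobi.kernel_eq ha hb hΔ n hx,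
      fun hc1 x => ?_, fun s hs x => BigJacobi.christoffel_eq_chihara ha hb hΔ n s hs x⟩,
    fun k hk => ?_, ?_⟩
  · rw [BigJacobi.monicJ_one]
    exact BigJacobi.kappa_ne_zero ha hb hΔ n
  · have hs : √(1 - c ^ 2) ^ 2 = 1 - c ^ 2 :=
      Real.sq_sqrt (by linarith [BigJacobi.sq_lt_one_of_abs hc1])
    exact BigJacobi.christoffel_eq_chihara (𝕜 := ℝ) ha hb hΔ n _ hs x
  · have h := BigJacobi.functional_christoffel_mul ha hb hc n (monic_X_pow k)
      (by rw [natDegree_X_pow]; exact hk)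
    simp only [natDegree_X_pow, eval_pow, eval_X] at h
    simp only [BigJacobi.sub_one_mul_kernel ha hb hΔ]
    exact h
  · have h := BigJacobi.functional_christoffel_mul ha hb hc n hmonic hdeg.le
    rw [if_pos hdeg, mul_one] at h
    rw [← h]
    congr 1
    funext x
    by_cases hx : x = 1
    · simp [hx]
    · rw [BigJacobi.kernel_eq ha hb hΔ n hx]
      ring
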